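/- Let $\mathsf k$ be a field and identify a monomial $x^ay^b\in\mathsf k[x,y]$ with $(a,b)\in\mathbb N_0^2$. **Notation.** For a monomial ideal $J\subseteq\mathsf k[x,y]$ let $G(J)$ be its set of minimal monomial generators, $\mu(J)=|G(J)|$, $\gcd(J)$ the greatest common divisor of its monomials, and $\operatorname{red}(J)=J:\gcd(J)$; $J$ is *anchored* if $\operatorname{red}(J)=J$. For $\bullet\in\{x,y\}$ let $\operatorname{dist}_\bullet(J)=\max\{\deg_\bullet f\mid f\in G(\operatorname{red}(J))\}$, and $\operatorname{dist}_\bullet(g,h)=\operatorname{dist}_\bullet((g,h))$ for monomials $g,h$. The *link* of monomial ideals $J,K$ is $$J\odot K=\operatorname{red}(J)\,y^{\operatorname{dist}_y(K)}+\operatorname{red}(K)\,x^{\operatorname{dist}_x(J)},$$ $J^{\odot\ell}$ is the link of $\ell$ copies of $J$, and the empty link is $(1)$. A generator $f\in G(J)$ is *persistent* if for all monomials $g,h\in J\setminus\{f\}$ there is no $n\ge1$ with $f^n\in(g,h)^n$, and *weakly persistent* if $f^n\in G(J^n)$ for all $n\ge1$. Write $P(J)$ and $P^*(J)$ for the sets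 of persistent and weakly persistent generators. **Segments.** Let $g,h$ be monomials with $u=\operatorname{dist}_x(g,h)\ge1$ and $v=\operatorname{dist}_y(g,h)\ge1$, so that, if neither divides the other, $\operatorname{red}((g,h))=(x^u,y^v)$. Let $J$ be an anchored monomial ideal, $r\ge\lceil\operatorname{dist}_y(J)/v\rceil$ an integer and $K=(x^u,y^v)^{r+1}J$. Put $L=\{f\in G(K)\mid \deg_yf\ge rv\}$, $M=\{f\in G(K)\mid rv\le\deg_yf<(r+1)v\}$, $R=\{f\in G(K)\mid\deg_yf<rv\}$, and let $x^\alpha y^\beta$ be the element of $L$ of least $y$-degree. The *$r$-segments* of $(g,h)J$ are $$\mathsf A=(L):y^\beta,\qquad \mathsf H=(M\cup\{x^{\alpha-u}y^{\beta+v}\}):x^{\alpha-u}y^\beta,\qquad \mathsf B=(R\cup\{x^\alpha y^\beta\}):x^\alpha .$$ **Theorem.** Let $I\subseteq\mathsf k[x,y]$ be an anchored monomial ideal that is not principal, and let $P=\{g_1,\dots,g_{k+1}\}$ with $P(I)\subseteq P\subseteq P^*(I)$, the $g_i$ ordered by strictly descending $y$-degree. Put $u_i=\operatorname{dist}_x(g_i,g_{i+1})$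 and $v_i=\operatorname{dist}_y(g_i,g_{i+1})$ for $1\le i\le k$, $\delta_P=\max_{1\le i\le k}\min\{u_i,v_i\}-1$, and $d_P=\min\{\operatorname{dist}_xI,\operatorname{dist}_yI\}-2$ if $|P|>2$, $d_P=0$ if $|P|=2$. Let $$D\ge D_P:=(\mu(I)-|P|)\,\delta_P+|P|\,d_P,\qquad r_y(P,D)=\Big\lceil D\cdot\max_{1\le i\le k}\frac{\operatorname{dist}_yI}{v_i}\Big\rceil,\qquad s\ge D+r_y(P,D)+1$$ be integers, and $r=s-D-1$. For $1\le i\le k$ let $\mathsf A_i,\mathsf H_i,\mathsf B_i$ be the $r$-segments of $(g_i,g_{i+1})I^D$, and let $\mathsf C_0=\mathsf A_1$, $\mathsf C_k=\mathsf B_k$ and $$\mathsf C_i=\mathsf B_i\,y^{(r+1)v_{i+1}-\operatorname{dist}_y\mathsf B_{i+1}}+\mathsf A_{i+1}\,x^{(r+1)u_i-\operatorname{dist}_x\mathsf A_i}\qquad(1\le i<k)$$ (the ideals $\mathsf C_i$, $\mathsf H_i$ are the *$(s,y)$-stable components* of $I$ with respect to $P$ and $D$). Then for every $\ell\ge0$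 $$I^{s+\ell}=\mathsf C_0\odot\bigodot_{i=1}^{k}\left(\mathsf H_i^{\odot\ell}\odot\mathsf C_i\right).$$ Moreover, the stable components are colon ideals of $I^s$: let $h_0=g_1^s$, $h_{k+1}=g_{k+1}^s$, and for $1\le i\le k$ let $h_i$ be the element of least $y$-degree among all $f\in G(I^s)$ with $\deg_yf\ge rv_i+(r+1)\deg_yg_{i+1}$. Then $\mathsf C_i=I^s:\gcd(h_i,h_{i+1})$ for $0\le i\le k$ and $\mathsf H_i=I^s:(h_i/x^{u_i})$ for $1\le i\le k$. -/

import Mathlib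

namespace StableLink

noncomputable section

/-- The polynomial ring `𝕜[x, y]`, with `x = X 0` and `y = X 1`. -/
abbrev Poly (𝕜 : Type*) [Field 𝕜] := MvPolynomial (Fin 2) 𝕜

/-- The monomial `x ^ a * y ^ b`. Monomials are identified with lattice points `(a, b)`, so that
`e.1` and `e.2` are the `x`- and `y`-degree, divisibility is the componentwise order, the product
is `+`, the `n`-th power is `n • e`, and the gcd is `⊓`. -/
def mon (𝕜 : Type*) [Field 𝕜] (e : ℕ × ℕ) : Poly 𝕜 :=
  MvPolynomial.X 0 ^ e.1 * MvPolynomial.X 1 ^ e.2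

/-- The ideal generated by a set of monomials. -/
def monIdeal (𝕜 : Type*) [Field 𝕜] (E : Set (ℕ × ℕ)) : Ideal (Poly 𝕜) :=
  Ideal.span (mon 𝕜 '' E)

variable {𝕜 : Type*} [Field 𝕜]

/-- `I` is a monomial ideal: it is generated by monomials. -/
def IsMonomialIdeal (I : Ideal (Poly 𝕜)) : Prop :=
  ∃ E : Set (ℕ × ℕ), I = monIdeal 𝕜 E

/-- The minimal monomial generators of a monomial ideal: the monomials of `I` that are minimal
with respect to divisibility. -/
def mingens (I : Ideal (Poly 𝕜)) : Set (ℕ × ℕ) :=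
  {e | Minimal (fun f => mon 𝕜 f ∈ I) e}

/-- The number of minimal generators. -/
def mu (I : Ideal (Poly 𝕜)) : ℕ := (mingens I).ncard

/-- The colon ideal `I : m` of `I` by the monomial `m`. -/
def colonMon (I : Ideal (Poly 𝕜)) (m : ℕ × ℕ) : Ideal (Poly 𝕜) :=
  Submodule.colon I {mon 𝕜 m}

/-- The greatest common divisor of all monomials in `I`. -/
def gcdMon (I : Ideal (Poly 𝕜)) : ℕ × ℕ :=
  (sInf {a | ∃ e : ℕ × ℕ, mon 𝕜 e ∈ I ∧ e.1 = a}, sInf {b | ∃ e : ℕ × ℕ, mon 𝕜 e ∈ I ∧ e.2 = b})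

/-- `I : gcd(I)`. -/
def red (I : Ideal (Poly 𝕜)) : Ideal (Poly 𝕜) := colonMon I (gcdMon I)

/-- `I` is anchored if `I : gcd(I) = I`. -/
def IsAnchored (I : Ideal (Poly 𝕜)) : Prop := red I = I

/-- The `x`-distance of `I`: the maximal `x`-degree of a minimal generator of `I : gcd(I)`. -/
def distX (I : Ideal (Poly 𝕜)) : ℕ := sSup {a | ∃ e ∈ mingens (red I), e.1 = a}

/-- The `y`-distance of `I`: the maximal `y`-degree of a minimal generator of `I : gcd(I)`. -/
def distY (I : Ideal (Poly 𝕜)) : ℕ := sSup {b | ∃ e ∈ mingens (red I), e.2 = b}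

/-- The monomial `f` lies in the integral closure of `J`. -/
def InIntegralClosure (J : Ideal (Poly 𝕜)) (f : ℕ × ℕ) : Prop :=
  ∃ n : ℕ, 1 ≤ n ∧ mon 𝕜 f ^ n ∈ J ^ n

/-- The persistent generators `P(I)`. -/
def persistent (I : Ideal (Poly 𝕜)) : Set (ℕ × ℕ) :=
  {f | f ∈ mingens I ∧ ∀ g h : ℕ × ℕ, mon 𝕜 g ∈ I → mon 𝕜 h ∈ I → g ≠ f → h ≠ f →
    ¬ InIntegralClosure (monIdeal 𝕜 {g, h}) f}

/-- The weakly persistent generators `P*(I)`. -/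
def weaklyPersistent (I : Ideal (Poly 𝕜)) : Set (ℕ × ℕ) :=
  {f | f ∈ mingens I ∧ ∀ n : ℕ, 1 ≤ n → n • f ∈ mingens (I ^ n)}

/-! ### The link of ideals (with respect to `y`) -/

/-- The link `I ⊙ J = red(I) * y ^ dist_y(J) + red(J) * x ^ dist_x(I)`. -/
def link (I J : Ideal (Poly 𝕜)) : Ideal (Poly 𝕜) :=
  red I * monIdeal 𝕜 {(0, distY J)} + red J * monIdeal 𝕜 {(distX I, 0)}

/-- The iterated link `J₁ ⊙ J₂ ⊙ ⋯ ⊙ Jₙ` of a list of ideals; the empty link is the unit ideal,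
which is neutral for `⊙`. -/
def linkList : List (Ideal (Poly 𝕜)) → Ideal (Poly 𝕜)
  | [] => ⊤
  | [J] => J
  | J :: K :: l => link J (linkList (K :: l))

/-- `I ⊙ I ⊙ ⋯ ⊙ I` with `l` factors. -/
def linkPow (I : Ideal (Poly 𝕜)) (l : ℕ) : Ideal (Poly 𝕜) := linkList (List.replicate l I)

/-! ### The `r`-segments of `(g, h) J`

With `u = dist_x(g, h)` and `v = dist_y(g, h)`, one has `red(g, h) = (x ^ u, y ^ v)`. -/

/-- The ideal `(x ^ u, y ^ v) ^ (r + 1) * J`. -/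
def segIdeal (g h : ℕ × ℕ) (J : Ideal (Poly 𝕜)) (r : ℕ) : Ideal (Poly 𝕜) :=
  red (monIdeal 𝕜 {g, h}) ^ (r + 1) * J

/-- `dist_x(g, h)`. -/
def pairX (𝕜 : Type*) [Field 𝕜] (g h : ℕ × ℕ) : ℕ := distX (monIdeal 𝕜 {g, h})

/-- `dist_y(g, h)`. -/
def pairY (𝕜 : Type*) [Field 𝕜] (g h : ℕ × ℕ) : ℕ := distY (monIdeal 𝕜 {g, h})

/-- The minimal generators with `deg_y ≥ r v`. -/
def setL (g h : ℕ × ℕ) (J : Ideal (Poly 𝕜)) (r : ℕ) : Set (ℕ × ℕ) :=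
  {f | f ∈ mingens (segIdeal g h J r) ∧ r * pairY 𝕜 g h ≤ f.2}

/-- The minimal generators with `r v ≤ deg_y < (r + 1) v`. -/
def setM (g h : ℕ × ℕ) (J : Ideal (Poly 𝕜)) (r : ℕ) : Set (ℕ × ℕ) :=
  {f | f ∈ mingens (segIdeal g h J r) ∧ r * pairY 𝕜 g h ≤ f.2 ∧ f.2 < (r + 1) * pairY 𝕜 g h}

/-- The minimal generators with `deg_y < r v`. -/
def setR (g h : ℕ × ℕ) (J : Ideal (Poly 𝕜)) (r : ℕ) : Set (ℕ × ℕ) :=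
  {f | f ∈ mingens (segIdeal g h J r) ∧ f.2 < r * pairY 𝕜 g h}

/-- The smallest `y`-degree `≥ bound` of a minimal generator of `K`, together with the `x`-degree
of the (unique) minimal generator that has this `y`-degree. -/
def lowestGen (K : Ideal (Poly 𝕜)) (bound : ℕ) : ℕ × ℕ :=
  let b := sInf {b | ∃ f ∈ mingens K, bound ≤ f.2 ∧ f.2 = b}
  (sInf {a | (a, b) ∈ mingens K}, b)

/-- The minimal generator `x ^ α * y ^ β` of `(x ^ u, y ^ v) ^ (r + 1) * J` with `β ≥ r v`
minimal. -/
def segPoint (g h : ℕ × ℕ) (J : Ideal (Poly 𝕜)) (r : ℕ) : ℕ × ℕ :=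
  lowestGen (segIdeal g h J r) (r * pairY 𝕜 g h)

/-- The segment `A = (L) : y ^ β`. -/
def segA (g h : ℕ × ℕ) (J : Ideal (Poly 𝕜)) (r : ℕ) : Ideal (Poly 𝕜) :=
  colonMon (monIdeal 𝕜 (setL g h J r)) (0, (segPoint g h J r).2)

/-- The segment `H = (M ∪ {x ^ (α - u) * y ^ (β + v)}) : x ^ (α - u) * y ^ β`.
Here `α ≥ u`, because `β < (r + 1) v`. -/
def segH (g h : ℕ × ℕ) (J : Ideal (Poly 𝕜)) (r : ℕ) : Ideal (Poly 𝕜) :=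
  let p := segPoint g h J r
  colonMon (monIdeal 𝕜 (setM g h J r ∪ {(p.1 - pairX 𝕜 g h, p.2 + pairY 𝕜 g h)}))
    (p.1 - pairX 𝕜 g h, p.2)

/-- The segment `B = (R ∪ {x ^ α * y ^ β}) : x ^ α`. -/
def segB (g h : ℕ × ℕ) (J : Ideal (Poly 𝕜)) (r : ℕ) : Ideal (Poly 𝕜) :=
  colonMon (monIdeal 𝕜 (setR g h J r ∪ {segPoint g h J r})) ((segPoint g h J r).1, 0)

/-! ### Numerical invariants

A finite set `P = {g₁, …, g_{k+1}}` of monomials is given by `k` and `g : ℕ → ℕ × ℕ`, of which only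
the values at `1, …, k + 1` are used. -/

/-- `δ_P = max_{1 ≤ i ≤ k} min {dist_x(g_i, g_{i+1}), dist_y(g_i, g_{i+1})} - 1`. -/
def deltaP (𝕜 : Type*) [Field 𝕜] (k : ℕ) (g : ℕ → ℕ × ℕ) : ℕ :=
  (Finset.Icc 1 k).sup (fun i => min (pairX 𝕜 (g i) (g (i + 1))) (pairY 𝕜 (g i) (g (i + 1)))) - 1

/-- `d_P = min {dist_x I, dist_y I} - 2` if `|P| > 2`, and `d_P = 0` if `|P| = 2`. -/
def dP (I : Ideal (Poly 𝕜)) (k : ℕ) : ℕ :=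
  if 2 < k + 1 then min (distX I) (distY I) - 2 else 0

/-- `D_P = (μ(I) - |P|) δ_P + |P| d_P`. -/
def boundD (I : Ideal (Poly 𝕜)) (k : ℕ) (g : ℕ → ℕ × ℕ) : ℕ :=
  (mu I - (k + 1)) * deltaP 𝕜 k g + (k + 1) * dP I k

/-- `r_y(P, D) = ⌈D * max_{1 ≤ i ≤ k} dist_y(I) / dist_y(g_i, g_{i+1})⌉`. -/
def rY (I : Ideal (Poly 𝕜)) (k : ℕ) (g : ℕ → ℕ × ℕ) (D : ℕ) : ℕ :=
  ⌈(D : ℚ≥0) * (Finset.Icc 1 k).sup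
    (fun i => (distY I : ℚ≥0) / (pairY 𝕜 (g i) (g (i + 1)) : ℚ≥0))⌉₊

/-! ### The `(s, y)`-stable components of `I` with respect to `P` and `D`

They are built from the `r`-segments of `(g_i, g_{i+1}) I ^ D` with `r = s - D - 1`. -/

/-- The stable component `H_i`, for `1 ≤ i ≤ k`. -/
def stableH (I : Ideal (Poly 𝕜)) (g : ℕ → ℕ × ℕ) (D s i : ℕ) : Ideal (Poly 𝕜) :=
  segH (g i) (g (i + 1)) (I ^ D) (s - D - 1)

/-- The stable component `C_i`, for `0 ≤ i ≤ k`: `C_0 = A_1`, `C_k = B_k`, and otherwise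
`C_i = B_i * y ^ ((r + 1) v_{i+1} - dist_y B_{i+1}) + A_{i+1} * x ^ ((r + 1) u_i - dist_x A_i)`. -/
def stableC (I : Ideal (Poly 𝕜)) (k : ℕ) (g : ℕ → ℕ × ℕ) (D s i : ℕ) : Ideal (Poly 𝕜) :=
  let r := s - D - 1
  let A : ℕ → Ideal (Poly 𝕜) := fun j => segA (g j) (g (j + 1)) (I ^ D) r
  let B : ℕ → Ideal (Poly 𝕜) := fun j => segB (g j) (g (j + 1)) (I ^ D) r
  if i = 0 then A 1
  else if i = k then B k
  else
    B i * monIdeal 𝕜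
        {(0, (r + 1) * pairY 𝕜 (g (i + 1)) (g (i + 2)) - distY (B (i + 1)))} +
      A (i + 1) * monIdeal 𝕜
        {((r + 1) * pairX 𝕜 (g i) (g (i + 1)) - distX (A i), 0)}

/-- The link points `h_0 = g_1 ^ s`, `h_1, …, h_k`, `h_{k+1} = g_{k+1} ^ s` of `I ^ s`. For
`1 ≤ i ≤ k`, `h_i` is the minimal generator of `I ^ s` of smallest `y`-degree
`≥ r v_i + (r + 1) deg_y g_{i+1}`, where `r = s - D - 1` and `v_i = dist_y(g_i, g_{i+1})`. -/
def linkPoint (I : Ideal (Poly 𝕜)) (k : ℕ) (g : ℕ → ℕ × ℕ) (D s i : ℕ) : ℕ × ℕ :=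
  if i = 0 then s • g 1
  else if i = k + 1 then s • g (k + 1)
  else lowestGen (I ^ s)
    ((s - D - 1) * pairY 𝕜 (g i) (g (i + 1)) + (s - D - 1 + 1) * (g (i + 1)).2)

end

end StableLink

/-! A monomial ideal T of `𝕜[x, y]` is a staircase, and for minimal generators p, q of T the ideal T
: gcd(p, q) (`between`) is the portion of the staircase from p to q. The link glues two portions at
a common corner (`link_between`). It therefore suffices to cut the staircase of I^(s+ℓ) at suitable
minimal generators so that the portions do not depend on ℓ. The cut points are h_i g_i^(ℓ-t)
g_(i+1)^t for 0 ≤ t ≤ ℓ, together with the ends g_1^(s+ℓ) and g_(k+1)^(s+ℓ), which are pure powers.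
Consecutive points with the same i bound a copy of H_i; the portion from h_i g_(i+1)^ℓ to h_(i+1)
g_(i+1)^ℓ is C_i.

The global input is `exists_decomposition`: I^(N+D) is the sum of the bands (g_i, g_(i+1))^N I^D. It
is an exchange argument. In a factorization with as few factors outside P as possible, and then with
least convex potential, each generator outside P occurs at most δ_P times and two non-neighbours in
P do not both occur more than d_P times. Apart from one neighbouring pair, at most D factors remain.

The local input is that band i is the whole power at y-degrees from N deg_y g_(i+1) + B up to N
deg_y g_i, where y^B is the least power of y in I^D (`inBand_of_mem`), and that near g_j a factor
g_j can be cancelled (`exists_eq_add`). The bound on r gives B ≤ r v_i, so the cuts fall into this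
range. Cancellation then shows that the cut points are minimal generators (`add_nsmul_mem_mingens`)
and that the portions are stable (`mon_mem_segH`, `mon_mem_segments_middle` and its two end cases).
-/

namespace StableLink

/-! ### Monomial ideals as up-closed sets of lattice points. -/

section Monomials

variable {𝕜 : Type*} [Field 𝕜]

/-- The exponent pair of a monomial as a finitely supported function. -/
noncomputable def toFinsupp (e : ℕ × ℕ) : Fin 2 →₀ ℕ := Finsupp.single 0 e.1 + Finsupp.single 1 e.2

@[simp] lemma toFinsupp_zero (e : ℕ × ℕ) : toFinsupp e 0 = e.1 := by simp [toFinsupp]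

@[simp] lemma toFinsupp_one (e : ℕ × ℕ) : toFinsupp e 1 = e.2 := by simp [toFinsupp]

lemma toFinsupp_apply_pair (d : Fin 2 →₀ ℕ) : toFinsupp (d 0, d 1) = d := by
  ext i; fin_cases i <;> simp

lemma toFinsupp_le_iff {e f : ℕ × ℕ} : toFinsupp e ≤ toFinsupp f ↔ e ≤ f := by
  simp [Finsupp.le_def, Fin.forall_fin_two, Prod.le_def]

lemma mon_eq_monomial (e : ℕ × ℕ) : mon 𝕜 e = MvPolynomial.monomial (toFinsupp e) 1 := by
  simp [mon, toFinsupp, MvPolynomial.X_pow_eq_monomial, MvPolynomial.monomial_mul]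

lemma mon_add (e f : ℕ × ℕ) : mon 𝕜 (e + f) = mon 𝕜 e * mon 𝕜 f := by
  simp only [mon, Prod.fst_add, Prod.snd_add, pow_add]; ring

lemma mon_zero : mon 𝕜 (0 : ℕ × ℕ) = 1 := by simp [mon]

lemma mon_nsmul (n : ℕ) (e : ℕ × ℕ) : mon 𝕜 (n • e) = mon 𝕜 e ^ n := by
  simp only [mon, Prod.smul_fst, Prod.smul_snd, smul_eq_mul, mul_pow, ← pow_mul, mul_comm]

lemma mon_mem_of_le {I : Ideal (Poly 𝕜)} {e f : ℕ × ℕ} (h : mon 𝕜 e ∈ I) (hef : e ≤ f) :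
    mon 𝕜 f ∈ I := by
  obtain ⟨d, rfl⟩ := exists_add_of_le hef
  rw [mon_add]
  exact I.mul_mem_right _ h

lemma mem_monIdeal_iff_support {E : Set (ℕ × ℕ)} {p : Poly 𝕜} :
    p ∈ monIdeal 𝕜 E ↔ ∀ d ∈ p.support, ∃ f ∈ E, f ≤ (d 0, d 1) := by
  have : mon 𝕜 '' E = (fun s => MvPolynomial.monomial s (1 : 𝕜)) '' (toFinsupp '' E) := by
    rw [Set.image_image]
    exact Set.image_congr fun e _ => mon_eq_monomial e
  rw [monIdeal, this, MvPolynomial.mem_ideal_span_monomial_image]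
  refine forall₂_congr fun d _ => ?_
  rw [Set.exists_mem_image]
  refine exists_congr fun f => and_congr_right fun _ => ?_
  conv_lhs => rw [← toFinsupp_apply_pair d]
  exact toFinsupp_le_iff

lemma mon_mem_monIdeal {E : Set (ℕ × ℕ)} {e : ℕ × ℕ} :
    mon 𝕜 e ∈ monIdeal 𝕜 E ↔ ∃ f ∈ E, f ≤ e := by
  classical
  rw [mem_monIdeal_iff_support, mon_eq_monomial, MvPolynomial.support_monomial,
    if_neg one_ne_zero]
  simp only [Finset.mem_singleton, forall_eq, toFinsupp_zero, toFinsupp_one]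

lemma isMonomialIdeal_monIdeal (E : Set (ℕ × ℕ)) : IsMonomialIdeal (monIdeal 𝕜 E) := ⟨E, rfl⟩

lemma IsMonomialIdeal.mem_iff {I : Ideal (Poly 𝕜)} (hI : IsMonomialIdeal I) {p : Poly 𝕜} :
    p ∈ I ↔ ∀ d ∈ p.support, mon 𝕜 (d 0, d 1) ∈ I := by
  obtain ⟨E, rfl⟩ := hI
  simp_rw [mem_monIdeal_iff_support (p := p), mon_mem_monIdeal]

lemma isMonomialIdeal_of_support {I : Ideal (Poly 𝕜)}
    (h : ∀ p ∈ I, ∀ d ∈ p.support, mon 𝕜 (d 0, d 1) ∈ I) : IsMonomialIdeal I := by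
  refine ⟨{e | mon 𝕜 e ∈ I}, le_antisymm (fun p hp => ?_) ?_⟩
  · exact mem_monIdeal_iff_support.2 fun d hd => ⟨_, h p hp d hd, le_rfl⟩
  · rw [monIdeal, Ideal.span_le]
    rintro _ ⟨e, he, rfl⟩
    exact he

/-- This reduces the identification of the stable components to statements about lattice points. -/
lemma IsMonomialIdeal.ext {I J : Ideal (Poly 𝕜)} (hI : IsMonomialIdeal I) (hJ : IsMonomialIdeal J)
    (h : ∀ e, mon 𝕜 e ∈ I ↔ mon 𝕜 e ∈ J) : I = J := by
  ext p
  rw [hI.mem_iff, hJ.mem_iff]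
  exact forall₂_congr fun d _ => h _

lemma monIdeal_mul (E F : Set (ℕ × ℕ)) :
    monIdeal 𝕜 E * monIdeal 𝕜 F = monIdeal 𝕜 (Set.image2 (· + ·) E F) := by
  unfold monIdeal
  rw [Ideal.span_mul_span', ← Set.image2_mul, Set.image_image2,
    Set.image2_image_left, Set.image2_image_right]
  exact congrArg Ideal.span (Set.image2_congr fun a _ b _ => (mon_add (𝕜 := 𝕜) a b).symm)

lemma IsMonomialIdeal.mul {I J : Ideal (Poly 𝕜)} (hI : IsMonomialIdeal I)
    (hJ : IsMonomialIdeal J) : IsMonomialIdeal (I * J) := by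
  obtain ⟨E, rfl⟩ := hI
  obtain ⟨F, rfl⟩ := hJ
  exact ⟨_, monIdeal_mul E F⟩

lemma isMonomialIdeal_top : IsMonomialIdeal (⊤ : Ideal (Poly 𝕜)) :=
  isMonomialIdeal_of_support fun _ _ _ _ => trivial

lemma IsMonomialIdeal.pow {I : Ideal (Poly 𝕜)} (hI : IsMonomialIdeal I) (n : ℕ) :
    IsMonomialIdeal (I ^ n) := by
  induction n with
  | zero => rw [pow_zero, Ideal.one_eq_top]; exact isMonomialIdeal_top
  | succ n ih => rw [pow_succ]; exact ih.mul hI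

lemma monIdeal_sup (E F : Set (ℕ × ℕ)) :
    monIdeal 𝕜 E + monIdeal 𝕜 F = monIdeal 𝕜 (E ∪ F) := by
  rw [monIdeal, monIdeal, monIdeal, Set.image_union, Ideal.span_union, Submodule.add_eq_sup]

lemma IsMonomialIdeal.add {I J : Ideal (Poly 𝕜)} (hI : IsMonomialIdeal I)
    (hJ : IsMonomialIdeal J) : IsMonomialIdeal (I + J) := by
  obtain ⟨E, rfl⟩ := hI
  obtain ⟨F, rfl⟩ := hJ
  exact ⟨_, monIdeal_sup E F⟩

lemma IsMonomialIdeal.mon_mem_mul {I J : Ideal (Poly 𝕜)} (hI : IsMonomialIdeal I)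
    (hJ : IsMonomialIdeal J) {e : ℕ × ℕ} :
    mon 𝕜 e ∈ I * J ↔ ∃ a b, mon 𝕜 a ∈ I ∧ mon 𝕜 b ∈ J ∧ a + b ≤ e := by
  constructor
  · intro h
    obtain ⟨E, rfl⟩ := hI
    obtain ⟨F, rfl⟩ := hJ
    rw [monIdeal_mul, mon_mem_monIdeal] at h
    obtain ⟨_, ⟨a, ha, b, hb, rfl⟩, hab⟩ := h
    exact ⟨a, b, mon_mem_monIdeal.2 ⟨a, ha, le_rfl⟩, mon_mem_monIdeal.2 ⟨b, hb, le_rfl⟩, hab⟩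
  · rintro ⟨a, b, ha, hb, hab⟩
    refine mon_mem_of_le ?_ hab
    rw [mon_add]
    exact Ideal.mul_mem_mul ha hb

lemma IsMonomialIdeal.mon_mem_add {I J : Ideal (Poly 𝕜)} (hI : IsMonomialIdeal I)
    (hJ : IsMonomialIdeal J) {e : ℕ × ℕ} :
    mon 𝕜 e ∈ I + J ↔ mon 𝕜 e ∈ I ∨ mon 𝕜 e ∈ J := by
  obtain ⟨E, rfl⟩ := hI
  obtain ⟨F, rfl⟩ := hJ
  simp_rw [monIdeal_sup, mon_mem_monIdeal, Set.mem_union, or_and_right, exists_or]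

lemma mon_mem_colonMon {I : Ideal (Poly 𝕜)} {m e : ℕ × ℕ} :
    mon 𝕜 e ∈ colonMon I m ↔ mon 𝕜 (e + m) ∈ I := by
  rw [colonMon, Submodule.mem_colon_singleton, smul_eq_mul, mon_add]

lemma IsMonomialIdeal.colonMon {I : Ideal (Poly 𝕜)} (hI : IsMonomialIdeal I) (m : ℕ × ℕ) :
    IsMonomialIdeal (colonMon I m) := by
  refine isMonomialIdeal_of_support fun p hp d hd => ?_
  rw [StableLink.colonMon, Submodule.mem_colon_singleton, smul_eq_mul, hI.mem_iff] at hp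
  have := hp (d + toFinsupp m) (by
    rw [MvPolynomial.mem_support_iff, mon_eq_monomial, MvPolynomial.coeff_mul_monomial, mul_one]
    exact MvPolynomial.mem_support_iff.1 hd)
  rw [mon_mem_colonMon]
  simp only [Finsupp.add_apply, toFinsupp_zero, toFinsupp_one] at this
  exact this

lemma mon_mem_mul_monIdeal_singleton {I : Ideal (Poly 𝕜)} (hI : IsMonomialIdeal I)
    {m e : ℕ × ℕ} :
    mon 𝕜 e ∈ I * monIdeal 𝕜 {m} ↔ ∃ a, mon 𝕜 a ∈ I ∧ e = a + m := by
  rw [hI.mon_mem_mul (isMonomialIdeal_monIdeal _)]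
  constructor
  · rintro ⟨a, b, ha, hb, hab⟩
    obtain ⟨_, rfl, hm⟩ := mon_mem_monIdeal.1 hb
    obtain ⟨c, rfl⟩ := exists_add_of_le ((add_le_add_right hm a).trans hab)
    exact ⟨a + c, mon_mem_of_le ha le_self_add, by abel⟩
  · rintro ⟨a, ha, rfl⟩
    exact ⟨a, m, ha, mon_mem_monIdeal.2 ⟨m, rfl, le_rfl⟩, le_rfl⟩

lemma exists_mingens_le {I : Ideal (Poly 𝕜)} {e : ℕ × ℕ} (he : mon 𝕜 e ∈ I) :
    ∃ f ∈ mingens I, f ≤ e := by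
  obtain ⟨f, hf, hf'⟩ := exists_minimal_le_of_wellFoundedLT (fun f => mon 𝕜 f ∈ I) e he
  exact ⟨f, hf', hf⟩

/-- A monomial of `I ^ n` is a multiple of a product of `n` minimal generators of `I`. -/
lemma IsMonomialIdeal.mon_mem_pow {I : Ideal (Poly 𝕜)} (hI : IsMonomialIdeal I) {n : ℕ}
    {e : ℕ × ℕ} :
    mon 𝕜 e ∈ I ^ n ↔ ∃ M : Multiset (ℕ × ℕ), M.card = n ∧ (∀ f ∈ M, f ∈ mingens I) ∧
      M.sum ≤ e := by
  induction n generalizing e with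
  | zero =>
    simp only [pow_zero, Ideal.one_eq_top, Submodule.mem_top, true_iff]
    exact ⟨0, rfl, by simp, by simp⟩
  | succ n ih =>
    rw [pow_succ, (hI.pow n).mon_mem_mul hI]
    constructor
    · rintro ⟨a, b, ha, hb, hab⟩
      obtain ⟨M, hM, hMI, hMa⟩ := ih.1 ha
      obtain ⟨f, hf, hfb⟩ := exists_mingens_le hb
      refine ⟨f ::ₘ M, by simp [hM], Multiset.forall_mem_cons.2 ⟨hf, hMI⟩, ?_⟩
      rw [Multiset.sum_cons, add_comm]
      exact (add_le_add hMa hfb).trans hab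
    · rintro ⟨M, hM, hMI, hMe⟩
      obtain ⟨f, hf⟩ := Multiset.card_pos_iff_exists_mem.1 (show 0 < M.card by omega)
      obtain ⟨M', rfl⟩ := Multiset.exists_cons_of_mem hf
      rw [Multiset.card_cons, add_left_inj] at hM
      rw [Multiset.forall_mem_cons] at hMI
      rw [Multiset.sum_cons] at hMe
      exact ⟨M'.sum, f, ih.2 ⟨M', hM, hMI.2, le_rfl⟩, hMI.1.1, by rwa [add_comm]⟩

lemma sum_mem_pow {I : Ideal (Poly 𝕜)} {M : Multiset (ℕ × ℕ)} (hM : ∀ f ∈ M, mon 𝕜 f ∈ I) :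
    mon 𝕜 M.sum ∈ I ^ M.card := by
  induction M using Multiset.induction with
  | empty => simp
  | cons a M ih =>
    rw [Multiset.sum_cons, Multiset.card_cons, mon_add, pow_succ, mul_comm (mon 𝕜 a)]
    exact Ideal.mul_mem_mul (ih fun f hf => hM f (Multiset.mem_cons_of_mem hf))
      (hM a (Multiset.mem_cons_self a M))

lemma nsmul_mem_pow {I : Ideal (Poly 𝕜)} {e : ℕ × ℕ} (he : mon 𝕜 e ∈ I) (n : ℕ) :
    mon 𝕜 (n • e) ∈ I ^ n := by
  rw [mon_nsmul]; exact Ideal.pow_mem_pow he n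

lemma add_mem_pow {I : Ideal (Poly 𝕜)} {e f : ℕ × ℕ} {m n : ℕ} (he : mon 𝕜 e ∈ I ^ m)
    (hf : mon 𝕜 f ∈ I ^ n) : mon 𝕜 (e + f) ∈ I ^ (m + n) := by
  rw [mon_add, pow_add]; exact Ideal.mul_mem_mul he hf

lemma mem_pow_monIdeal_pair {g h e : ℕ × ℕ} {n : ℕ} :
    mon 𝕜 e ∈ monIdeal 𝕜 {g, h} ^ n ↔ ∃ a b : ℕ, a + b = n ∧ a • g + b • h ≤ e := by
  induction n generalizing e with
  | zero =>
    simp only [pow_zero, Ideal.one_eq_top, Submodule.mem_top, true_iff]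
    exact ⟨0, 0, rfl, by simp⟩
  | succ n ih =>
    rw [pow_succ, ((isMonomialIdeal_monIdeal _).pow n).mon_mem_mul (isMonomialIdeal_monIdeal _)]
    constructor
    · rintro ⟨p, q, hp, hq, hpq⟩
      obtain ⟨a, b, rfl, hab⟩ := ih.1 hp
      obtain ⟨f, hf, hfq⟩ := mon_mem_monIdeal.1 hq
      rcases hf with rfl | rfl
      · refine ⟨a + 1, b, by omega, le_trans (le_of_eq ?_) ((add_le_add hab hfq).trans hpq)⟩
        rw [succ_nsmul]; abel
      · refine ⟨a, b + 1, by omega, le_trans (le_of_eq ?_) ((add_le_add hab hfq).trans hpq)⟩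
        rw [succ_nsmul]; abel
    · rintro ⟨a, b, hab, hle⟩
      rcases a with _ | a
      · obtain rfl : b = n + 1 := by omega
        refine ⟨n • h, h, ih.2 ⟨0, n, by omega, by simp⟩,
          mon_mem_monIdeal.2 ⟨h, by simp, le_rfl⟩, ?_⟩
        rwa [zero_nsmul, zero_add, succ_nsmul] at hle
      · refine ⟨a • g + b • h, g, ih.2 ⟨a, b, by omega, le_rfl⟩,
          mon_mem_monIdeal.2 ⟨g, by simp, le_rfl⟩, le_trans (le_of_eq ?_) hle⟩
        rw [succ_nsmul]; abel

/-- Membership is monotone in each exponent, so minimality need only be tested one unit down in each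
coordinate. -/
lemma mem_mingens_iff {I : Ideal (Poly 𝕜)} {p : ℕ × ℕ} :
    p ∈ mingens I ↔ mon 𝕜 p ∈ I ∧ (∀ a, a + 1 = p.1 → mon 𝕜 (a, p.2) ∉ I) ∧
      ∀ b, b + 1 = p.2 → mon 𝕜 (p.1, b) ∉ I := by
  constructor
  · rintro ⟨hp, hmin⟩
    refine ⟨hp, fun a ha h => ?_, fun b hb h => ?_⟩
    · have := (hmin h ⟨by simp; omega, le_rfl⟩).1
      simp at this; omega
    · have := (hmin h ⟨le_rfl, by simp; omega⟩).2
      simp at this; omega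
  · rintro ⟨hp, h1, h2⟩
    refine ⟨hp, fun q hq hqp => ?_⟩
    by_contra hlt
    have : q.1 < p.1 ∨ q.2 < p.2 := by
      by_contra! h
      exact hlt ⟨h.1, h.2⟩
    rcases this with h | h
    · exact h1 (p.1 - 1) (by omega) (mon_mem_of_le hq ⟨by simp; omega, hqp.2⟩)
    · exact h2 (p.2 - 1) (by omega) (mon_mem_of_le hq ⟨hqp.1, by simp; omega⟩)

lemma eq_of_le_mingens {I : Ideal (Poly 𝕜)} {p q : ℕ × ℕ} (hp : p ∈ mingens I)
    (hq : mon 𝕜 q ∈ I) (h : q ≤ p) : q = p :=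
  le_antisymm h (hp.2 hq h)

/-- The staircase property; only `q` has to be minimal, since otherwise `p` would properly divide
it. -/
lemma snd_lt_of_fst_lt {I : Ideal (Poly 𝕜)} {p q : ℕ × ℕ} (hp : mon 𝕜 p ∈ I)
    (hq : q ∈ mingens I) (h : p.1 < q.1) : q.2 < p.2 := by
  by_contra! h'
  have := eq_of_le_mingens hq hp ⟨h.le, h'⟩
  rw [this] at h; omega

lemma fst_lt_of_snd_lt {I : Ideal (Poly 𝕜)} {p q : ℕ × ℕ} (hp : mon 𝕜 p ∈ I)
    (hq : q ∈ mingens I) (h : p.2 < q.2) : q.1 < p.1 := by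
  by_contra! h'
  have := eq_of_le_mingens hq hp ⟨h', h.le⟩
  rw [this] at h; omega

lemma mingens_ext_snd {I : Ideal (Poly 𝕜)} {p q : ℕ × ℕ} (hp : p ∈ mingens I)
    (hq : q ∈ mingens I) (h : p.2 = q.2) : p = q := by
  rcases le_total p.1 q.1 with h' | h'
  · exact eq_of_le_mingens hq hp.1 ⟨h', h.le⟩
  · exact (eq_of_le_mingens hp hq.1 ⟨h', h.ge⟩).symm

end Monomials

/-! ### Reductions, distances and pairs of monomials. -/

section Reduction

variable {𝕜 : Type*} [Field 𝕜]

lemma red_eq_self {I : Ideal (Poly 𝕜)} {a b : ℕ} (ha : mon 𝕜 (a, 0) ∈ I)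
    (hb : mon 𝕜 (0, b) ∈ I) : red I = I := by
  have : gcdMon I = (0, 0) := by
    rw [gcdMon, Prod.mk.injEq]
    exact ⟨Nat.sInf_eq_zero.2 (Or.inl ⟨_, hb, rfl⟩), Nat.sInf_eq_zero.2 (Or.inl ⟨_, ha, rfl⟩)⟩
  rw [red, this]
  ext p
  rw [colonMon, Submodule.mem_colon_singleton]
  simp [mon]

lemma distX_eq {I : Ideal (Poly 𝕜)} {a b : ℕ} (ha : (a, 0) ∈ mingens I)
    (hb : mon 𝕜 (0, b) ∈ I) : distX I = a := by
  rw [distX, red_eq_self ha.1 hb]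
  refine IsGreatest.csSup_eq ⟨⟨_, ha, rfl⟩, ?_⟩
  rintro _ ⟨e, he, rfl⟩
  by_contra! h
  have := snd_lt_of_fst_lt ha.1 he h
  simp at this

lemma distY_eq {I : Ideal (Poly 𝕜)} {a b : ℕ} (ha : mon 𝕜 (a, 0) ∈ I)
    (hb : (0, b) ∈ mingens I) : distY I = b := by
  rw [distY, red_eq_self ha hb.1]
  refine IsGreatest.csSup_eq ⟨⟨_, hb, rfl⟩, ?_⟩
  rintro _ ⟨e, he, rfl⟩
  by_contra! h
  have := fst_lt_of_snd_lt hb.1 he h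
  simp at this

lemma exists_pure_powers {I : Ideal (Poly 𝕜)} (hI : IsMonomialIdeal I) (hanch : IsAnchored I)
    (h0 : I ≠ ⊥) : (∃ a, (a, 0) ∈ mingens I) ∧ ∃ b, (0, b) ∈ mingens I := by
  obtain ⟨e, he⟩ : ∃ e, mon 𝕜 e ∈ I := by
    by_contra! h
    refine h0 ((Submodule.eq_bot_iff _).2 fun p hp => ?_)
    rw [hI.mem_iff] at hp
    by_contra hp0
    obtain ⟨d, hd⟩ := MvPolynomial.support_nonempty.2 hp0
    exact h _ (hp d hd)
  -- For f of least y-degree, x^(deg_x f) · gcd(I) is a multiple of f, so anchoredness puts x^(deg_x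
  -- f) into I; likewise for y.
  have hmem : ∀ f, mon 𝕜 (f + gcdMon I) ∈ I → mon 𝕜 f ∈ I := fun f hf => by
    have h : mon 𝕜 f ∈ red I := mon_mem_colonMon.2 hf
    rwa [show red I = I from hanch] at h
  constructor
  · obtain ⟨f, hf, hf2⟩ := Nat.sInf_mem
      (s := {b | ∃ e : ℕ × ℕ, mon 𝕜 e ∈ I ∧ e.2 = b}) ⟨_, e, he, rfl⟩
    have h1 : mon 𝕜 (f.1, 0) ∈ I := hmem _ (mon_mem_of_le hf ⟨by simp, by
      rw [hf2]; simp [gcdMon]⟩)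
    obtain ⟨m, hm, hle⟩ := exists_mingens_le h1
    exact ⟨m.1, by convert hm using 1; ext <;> simp; exact (Nat.le_zero.1 hle.2).symm⟩
  · obtain ⟨f, hf, hf2⟩ := Nat.sInf_mem
      (s := {b | ∃ e : ℕ × ℕ, mon 𝕜 e ∈ I ∧ e.1 = b}) ⟨_, e, he, rfl⟩
    have h1 : mon 𝕜 (0, f.2) ∈ I := hmem _ (mon_mem_of_le hf ⟨by
      rw [hf2]; simp [gcdMon], by simp⟩)
    obtain ⟨m, hm, hle⟩ := exists_mingens_le h1
    exact ⟨m.2, by convert hm using 1; ext <;> simp; exact (Nat.le_zero.1 hle.1).symm⟩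

lemma gcdMon_pair {g h : ℕ × ℕ} (hx : g.1 < h.1) (hy : h.2 < g.2) :
    gcdMon (monIdeal 𝕜 {g, h}) = (g.1, h.2) := by
  have key : ∀ e, mon 𝕜 e ∈ monIdeal 𝕜 {g, h} ↔ g ≤ e ∨ h ≤ e := fun e => by
    simp [mon_mem_monIdeal]
  simp only [gcdMon, key, Prod.mk.injEq]
  constructor
  · refine IsLeast.csInf_eq ⟨⟨g, Or.inl le_rfl, rfl⟩, ?_⟩
    rintro _ ⟨e, he | he, rfl⟩
    · exact he.1
    · exact hx.le.trans he.1
  · refine IsLeast.csInf_eq ⟨⟨h, Or.inr le_rfl, rfl⟩, ?_⟩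
    rintro _ ⟨e, he | he, rfl⟩
    · exact hy.le.trans he.2
    · exact he.2

lemma red_pair {g h : ℕ × ℕ} (hx : g.1 < h.1) (hy : h.2 < g.2) :
    red (monIdeal 𝕜 {g, h}) = monIdeal 𝕜 {(0, g.2 - h.2), (h.1 - g.1, 0)} := by
  refine ((isMonomialIdeal_monIdeal _).colonMon _).ext (isMonomialIdeal_monIdeal _) fun e => ?_
  rw [mon_mem_colonMon, gcdMon_pair hx hy]
  simp only [mon_mem_monIdeal, Set.mem_insert_iff, Set.mem_singleton_iff, exists_eq_or_imp,
    exists_eq_left, Prod.le_def, Prod.fst_add, Prod.snd_add]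
  omega

lemma pair_mem_mingens {u v : ℕ} (hu : 0 < u) (hv : 0 < v) :
    (u, 0) ∈ mingens (monIdeal 𝕜 {((0 : ℕ), v), (u, 0)}) ∧
      (0, v) ∈ mingens (monIdeal 𝕜 {((0 : ℕ), v), (u, 0)}) := by
  simp only [mem_mingens_iff, mon_mem_monIdeal, Set.mem_insert_iff, Set.mem_singleton_iff,
    exists_eq_or_imp, exists_eq_left, Prod.le_def]
  refine ⟨⟨by simp, ?_, ?_⟩, by simp, ?_, ?_⟩ <;> intro a ha <;> omega

lemma pairX_eq {g h : ℕ × ℕ} (hx : g.1 < h.1) (hy : h.2 < g.2) :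
    pairX 𝕜 g h = h.1 - g.1 := by
  have := pair_mem_mingens (𝕜 := 𝕜) (Nat.sub_pos_of_lt hx) (Nat.sub_pos_of_lt hy)
  rw [pairX, distX, red_pair hx hy, ← red_eq_self this.1.1 this.2.1, ← distX,
    distX_eq this.1 this.2.1]

lemma pairY_eq {g h : ℕ × ℕ} (hx : g.1 < h.1) (hy : h.2 < g.2) :
    pairY 𝕜 g h = g.2 - h.2 := by
  have := pair_mem_mingens (𝕜 := 𝕜) (Nat.sub_pos_of_lt hx) (Nat.sub_pos_of_lt hy)
  rw [pairY, distY, red_pair hx hy, ← red_eq_self this.1.1 this.2.1, ← distY,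
    distY_eq this.1.1 this.2]

lemma lowestGen_eq {K : Ideal (Poly 𝕜)} {bound : ℕ} {q : ℕ × ℕ} (hq : q ∈ mingens K)
    (hb : bound ≤ q.2) (hmin : ∀ f ∈ mingens K, bound ≤ f.2 → q.2 ≤ f.2) :
    lowestGen K bound = q := by
  have h2 : sInf {b | ∃ f ∈ mingens K, bound ≤ f.2 ∧ f.2 = b} = q.2 := by
    refine IsLeast.csInf_eq ⟨⟨q, hq, hb, rfl⟩, ?_⟩
    rintro _ ⟨f, hf, hf', rfl⟩
    exact hmin f hf hf'
  have h1 : {a | (a, q.2) ∈ mingens K} = {q.1} := by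
    ext a
    simp only [Set.mem_ofPred_eq, Set.mem_singleton_iff]
    refine ⟨fun h => congrArg Prod.fst (mingens_ext_snd h hq rfl), ?_⟩
    rintro rfl
    exact hq
  simp only [lowestGen, h2, h1, csInf_singleton]

lemma exists_lowest_mingens {K : Ideal (Poly 𝕜)} {bound : ℕ}
    (h : ∃ f ∈ mingens K, bound ≤ f.2) :
    ∃ q ∈ mingens K, bound ≤ q.2 ∧ ∀ f ∈ mingens K, bound ≤ f.2 → q.2 ≤ f.2 := by
  obtain ⟨f, hf, hf'⟩ := h
  obtain ⟨q, ⟨hq, hq'⟩, hmin⟩ := WellFounded.has_min (measure (fun f : ℕ × ℕ => f.2)).wf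
    {f | f ∈ mingens K ∧ bound ≤ f.2} ⟨f, hf, hf'⟩
  exact ⟨q, hq, hq', fun e he he' => not_lt.1 (hmin e ⟨he, he'⟩)⟩

end Reduction

/-! ### Gluing portions of a staircase by links. -/

section Link

variable {𝕜 : Type*} [Field 𝕜]

/-- The part of the ideal `T` between the monomials `p` and `q` of `T`, where `p` has the larger
`y`-degree and `q` the larger `x`-degree: the ideal `T : gcd(p, q)`. -/
noncomputable def between (T : Ideal (Poly 𝕜)) (p q : ℕ × ℕ) : Ideal (Poly 𝕜) := colonMon T (p.1, q.2)

lemma mon_mem_between {T : Ideal (Poly 𝕜)} {p q e : ℕ × ℕ} :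
    mon 𝕜 e ∈ between T p q ↔ mon 𝕜 (e.1 + p.1, e.2 + q.2) ∈ T := mon_mem_colonMon

section

variable {T : Ideal (Poly 𝕜)} {p q : ℕ × ℕ} (hp : p ∈ mingens T) (hq : q ∈ mingens T)
  (hy : q.2 ≤ p.2)
include hp hq hy

lemma fst_le_fst_of_snd_le_snd : p.1 ≤ q.1 := by
  by_contra! h
  have := snd_lt_of_fst_lt hq.1 hp h
  omega

/-- Division by the gcd turns `p` and `q` into pure powers, which inherit minimality from `T`. Hence
such portions are anchored and their distances are coordinate differences. -/
lemma between_pure_powers : (q.1 - p.1, 0) ∈ mingens (between T p q) ∧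
    (0, p.2 - q.2) ∈ mingens (between T p q) := by
  have hx := fst_le_fst_of_snd_le_snd hp hq hy
  constructor
  · rw [mem_mingens_iff]
    refine ⟨?_, fun a ha h => ?_, fun b hb => by simp at hb⟩
    · rw [mon_mem_between]
      exact mon_mem_of_le hq.1 ⟨by simp; omega, by simp⟩
    · rw [mon_mem_between] at h
      simp only at ha h
      exact (mem_mingens_iff.1 hq).2.1 (a + p.1) (by omega) (by simpa using h)
  · rw [mem_mingens_iff]
    refine ⟨?_, fun b hb => by simp at hb, fun a ha h => ?_⟩
    · rw [mon_mem_between]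
      exact mon_mem_of_le hp.1 ⟨by simp, by simp; omega⟩
    · rw [mon_mem_between] at h
      simp only at ha h
      exact (mem_mingens_iff.1 hp).2.2 (a + q.2) (by omega) (by simpa using h)

lemma red_between : red (between T p q) = between T p q :=
  red_eq_self (between_pure_powers hp hq hy).1.1 (between_pure_powers hp hq hy).2.1

lemma distX_between : distX (between T p q) = q.1 - p.1 :=
  distX_eq (between_pure_powers hp hq hy).1 (between_pure_powers hp hq hy).2.1

lemma distY_between : distY (between T p q) = p.2 - q.2 :=
  distY_eq (between_pure_powers hp hq hy).1.1 (between_pure_powers hp hq hy).2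

end

lemma between_self {T : Ideal (Poly 𝕜)} {p : ℕ × ℕ} (hp : mon 𝕜 p ∈ T) : between T p p = ⊤ := by
  rw [Ideal.eq_top_iff_one, ← mon_zero, mon_mem_between]
  simpa using hp

/-- The shifts in the link compensate for the different gcds, so the summands are the parts of `T`
at or above the height of `q` and at or to the right of `q`. They cover everything: a monomial of
`T` lower than `q` lies to its right because `q` is minimal. -/
lemma link_between {T : Ideal (Poly 𝕜)} (hT : IsMonomialIdeal T) {p q r : ℕ × ℕ}
    (hp : p ∈ mingens T) (hq : q ∈ mingens T) (hr : r ∈ mingens T) (hpq : q.2 ≤ p.2)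
    (hqr : r.2 ≤ q.2) : link (between T p q) (between T q r) = between T p r := by
  have hx := fst_le_fst_of_snd_le_snd hp hq hpq
  have hx' := fst_le_fst_of_snd_le_snd hq hr hqr
  have m1 : IsMonomialIdeal (between T p q) := hT.colonMon _
  have m2 : IsMonomialIdeal (between T q r) := hT.colonMon _
  rw [link, red_between hp hq hpq, red_between hq hr hqr, distX_between hp hq hpq,
    distY_between hq hr hqr]
  refine ((m1.mul (isMonomialIdeal_monIdeal _)).add (m2.mul (isMonomialIdeal_monIdeal _))).ext
    (hT.colonMon _) fun e => ?_
  rw [(m1.mul (isMonomialIdeal_monIdeal _)).mon_mem_add (m2.mul (isMonomialIdeal_monIdeal _)),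
    mon_mem_mul_monIdeal_singleton m1, mon_mem_mul_monIdeal_singleton m2]
  simp only [mon_mem_between]
  constructor
  · rintro (⟨a, ha, rfl⟩ | ⟨a, ha, rfl⟩)
    · exact mon_mem_of_le ha ⟨by simp, by simp; omega⟩
    · exact mon_mem_of_le ha ⟨by simp; omega, by simp⟩
  · intro he
    by_cases h : q.2 ≤ e.2 + r.2
    · refine Or.inl ⟨(e.1, e.2 + r.2 - q.2), mon_mem_of_le he ⟨by simp, by simp; omega⟩, ?_⟩
      ext <;> simp; omega
    · have : q.1 < e.1 + p.1 := fst_lt_of_snd_lt he hq (by simpa using h)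
      refine Or.inr ⟨(e.1 + p.1 - q.1, e.2), mon_mem_of_le he ⟨by simp; omega, by simp⟩, ?_⟩
      ext <;> simp; omega

/-- The link of consecutive parts of an ideal is the part between the outermost points. -/
lemma linkList_between {T : Ideal (Poly 𝕜)} (hT : IsMonomialIdeal T) (q : ℕ → ℕ × ℕ) (m n : ℕ)
    (hq : ∀ i, m ≤ i → i ≤ m + n → q i ∈ mingens T)
    (hy : ∀ i, m ≤ i → i < m + n → (q (i + 1)).2 ≤ (q i).2) :
    linkList ((List.range' m n).map fun i => between T (q i) (q (i + 1))) =
      between T (q m) (q (m + n)) := by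
  induction n generalizing m with
  | zero => simp [linkList, between_self (hq m le_rfl (by omega)).1]
  | succ n ih =>
    have ih' := ih (m + 1) (fun i h1 h2 => hq i (by omega) (by omega))
      fun i h1 h2 => hy i (by omega) (by omega)
    rw [show m + 1 + n = m + (n + 1) by omega] at ih'
    -- `linkList [J]` is `J` itself, so the recursive clause requires a nonempty tail.
    rcases n with _ | n
    · simp [linkList, List.range']
    · rw [List.range'_succ, List.map_cons]
      have : ∀ (J : Ideal (Poly 𝕜)) (l : List (Ideal (Poly 𝕜))), l ≠ [] →
          linkList (J :: l) = link J (linkList l) := by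
        rintro J (_ | ⟨K, l⟩) h
        · exact absurd rfl h
        · rfl
      rw [this _ _ (by simp), ih']
      refine link_between hT (hq _ le_rfl (by omega)) (hq _ (by omega) (by omega))
        (hq _ (by omega) (by omega)) (hy _ le_rfl (by omega)) ?_
      have mono : ∀ j, m + 1 + j ≤ m + (n + 1 + 1) → (q (m + 1 + j)).2 ≤ (q (m + 1)).2 := by
        intro j
        induction j with
        | zero => intro _; simp
        | succ j ihj =>
          intro hj
          exact (hy (m + 1 + j) (by omega) (by omega)).trans (ihj (by omega))
      have := mono (n + 1) (by omega)
      rwa [show m + 1 + (n + 1) = m + (n + 1 + 1) by omega] at this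

end Link

/-! ### Convexity of the chain of weakly persistent generators. -/

section Decomposition

variable {𝕜 : Type*} [Field 𝕜]

/-- The monomials `g₁, …, g_{k+1}`, by descending `y`-degree, are weakly persistent generators of
the monomial ideal `I`, and all persistent generators are among them. -/
structure PersistentChain (I : Ideal (Poly 𝕜)) (k : ℕ) (g : ℕ → ℕ × ℕ) : Prop where
  isMonomial : IsMonomialIdeal I
  persistent_subset : persistent I ⊆ g '' Set.Icc 1 (k + 1)
  weaklyPersistent : ∀ i, 1 ≤ i → i ≤ k + 1 → g i ∈ weaklyPersistent I
  snd_lt : ∀ i j, 1 ≤ i → i < j → j ≤ k + 1 → (g j).2 < (g i).2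

namespace PersistentChain

variable {I : Ideal (Poly 𝕜)} {k : ℕ} {g : ℕ → ℕ × ℕ} (C : PersistentChain I k g)
include C

lemma mem_mingens {i : ℕ} (h1 : 1 ≤ i) (hk : i ≤ k + 1) : g i ∈ mingens I :=
  (C.weaklyPersistent i h1 hk).1

lemma fst_lt {i j : ℕ} (h1 : 1 ≤ i) (hij : i < j) (hj : j ≤ k + 1) : (g i).1 < (g j).1 :=
  fst_lt_of_snd_lt (C.mem_mingens (by omega) hj).1 (C.mem_mingens h1 (by omega))
    (C.snd_lt i j h1 hij hj)

lemma snd_le {i j : ℕ} (h1 : 1 ≤ i) (hij : i ≤ j) (hj : j ≤ k + 1) : (g j).2 ≤ (g i).2 := by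
  rcases hij.eq_or_lt with rfl | h
  · exact le_rfl
  · exact (C.snd_lt i j h1 h hj).le

lemma fst_le {i j : ℕ} (h1 : 1 ≤ i) (hij : i ≤ j) (hj : j ≤ k + 1) : (g i).1 ≤ (g j).1 := by
  rcases hij.eq_or_lt with rfl | h
  · exact le_rfl
  · exact (C.fst_lt h1 h hj).le

lemma nsmul_mem_mingens {j n : ℕ} (h1 : 1 ≤ j) (hj : j ≤ k + 1) :
    n • g j ∈ mingens (I ^ n) := by
  rcases Nat.eq_zero_or_pos n with rfl | hn
  · rw [mem_mingens_iff]
    simp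
  · exact (C.weaklyPersistent j h1 hj).2 n hn

lemma nsmul_add_nsmul_mem {i l p q : ℕ} (h1 : 1 ≤ i) (hi : i ≤ k + 1) (h1' : 1 ≤ l)
    (hl : l ≤ k + 1) : mon 𝕜 (q • g i + p • g l) ∈ I ^ (p + q) := by
  rw [add_comm p q]
  exact add_mem_pow (nsmul_mem_pow (C.mem_mingens h1 hi).1 q)
    (nsmul_mem_pow (C.mem_mingens h1' hl).1 p)

/-- A member of the chain lies below the segment spanned by two others. -/
lemma below_of_fst {i j l p q : ℕ} (h1 : 1 ≤ i) (hij : i < j) (hjl : j < l) (hl : l ≤ k + 1)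
    (hp : (g j).1 = (g i).1 + p) (hq : (g l).1 = (g j).1 + q) :
    (p + q) • g j ≤ q • g i + p • g l := by
  have hx : ((p + q) • g j).1 = (q • g i + p • g l).1 := by
    simp only [Prod.smul_fst, Prod.fst_add, smul_eq_mul, hq, hp]; ring
  refine ⟨hx.le, ?_⟩
  -- The x-degrees agree, so a failure would make the right-hand side a proper divisor of `(p + q) •
  -- g j`, which weak persistence makes minimal in the power.
  by_contra! h
  have := eq_of_le_mingens (C.nsmul_mem_mingens (n := p + q) (by omega : 1 ≤ j) (by omega))
    (C.nsmul_add_nsmul_mem h1 (by omega) (by omega) hl) ⟨hx.ge, h.le⟩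
  rw [this] at h
  exact lt_irrefl _ h

lemma below_of_snd {i j l p q : ℕ} (h1 : 1 ≤ i) (hij : i < j) (hjl : j < l) (hl : l ≤ k + 1)
    (hp : (g i).2 = (g j).2 + p) (hq : (g j).2 = (g l).2 + q) :
    (p + q) • g j ≤ q • g i + p • g l := by
  have hy : ((p + q) • g j).2 = (q • g i + p • g l).2 := by
    simp only [Prod.smul_snd, Prod.snd_add, smul_eq_mul, hq, hp]; ring
  refine ⟨?_, hy.le⟩
  by_contra! h
  have := eq_of_le_mingens (C.nsmul_mem_mingens (n := p + q) (by omega : 1 ≤ j) (by omega))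
    (C.nsmul_add_nsmul_mem h1 (by omega) (by omega) hl) ⟨h.le, hy.ge⟩
  rw [this] at h
  exact lt_irrefl _ h

/-- Of the three points `g m`, `g i`, `g (i + 1)` the middle one lies below the segment of the outer
two, which puts `g m` above the line through the other two. -/
lemma line_le_chain {i m u v : ℕ} (h1 : 1 ≤ i) (hi : i ≤ k) (hu : (g (i + 1)).1 = (g i).1 + u)
    (hv : (g i).2 = (g (i + 1)).2 + v) (h1' : 1 ≤ m) (hm : m ≤ k + 1) :
    v * (g i).1 + u * (g i).2 ≤ v * (g m).1 + u * (g m).2 := by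
  rcases lt_trichotomy m i with h | rfl | h
  · obtain ⟨p, hp⟩ := exists_add_of_le (C.fst_lt h1' h (by omega)).le
    have := (C.below_of_fst h1' h (Nat.lt_succ_self i) (by omega) hp hu).2
    simp only [Prod.smul_snd, Prod.snd_add, smul_eq_mul, hv] at this
    rw [hp, hv]
    nlinarith
  · exact le_rfl
  · rcases (show i + 1 ≤ m from h).eq_or_lt with rfl | h'
    · rw [hu, hv]; exact le_of_eq (by ring)
    · obtain ⟨q, hq⟩ := exists_add_of_le (C.fst_lt (by omega) h' hm).le
      have := (C.below_of_fst h1 (Nat.lt_succ_self i) h' hm hu hq).2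
      simp only [Prod.smul_snd, Prod.snd_add, smul_eq_mul, hv, Nat.succ_eq_add_one] at this
      rw [hq, hu, hv]
      nlinarith

/-- All monomials of `I` lie on or above the line through `g i` and `g (i + 1)`. -/
lemma line_le {i u v : ℕ} (h1 : 1 ≤ i) (hi : i ≤ k) (hu : (g (i + 1)).1 = (g i).1 + u)
    (hv : (g i).2 = (g (i + 1)).2 + v) {e : ℕ × ℕ} (he : mon 𝕜 e ∈ I) :
    v * (g i).1 + u * (g i).2 ≤ v * e.1 + u * e.2 := by
  have hu0 : 0 < u := by
    have := C.fst_lt h1 (Nat.lt_succ_self i) (by omega)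
    rw [Nat.succ_eq_add_one, hu] at this; omega
  have hv0 : 0 < v := by
    have := C.snd_lt i (i + 1) h1 (Nat.lt_succ_self i) (by omega)
    rw [hv] at this; omega
  -- Minimising the linear form, with ties broken by x-degree, picks a vertex of the Newton polygon.
  -- It is persistent, hence in the chain, where `line_le_chain` applies.
  obtain ⟨f, hf, hmin⟩ := WellFounded.has_min
    (InvImage.wf (fun f : ℕ × ℕ => toLex (v * f.1 + u * f.2, f.1)) wellFounded_lt)
    {f : ℕ × ℕ | mon 𝕜 f ∈ I} ⟨e, he⟩
  have hf : mon 𝕜 f ∈ I := hf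
  have hmin' : ∀ q, mon 𝕜 q ∈ I → v * f.1 + u * f.2 < v * q.1 + u * q.2 ∨
      v * f.1 + u * f.2 = v * q.1 + u * q.2 ∧ f.1 ≤ q.1 := by
    intro q hq
    have := hmin q hq
    rw [InvImage, not_lt, Prod.Lex.toLex_le_toLex] at this
    exact this
  have hle : ∀ q, mon 𝕜 q ∈ I → v * f.1 + u * f.2 ≤ v * q.1 + u * q.2 := fun q hq => by
    rcases hmin' q hq with h | h
    · exact h.le
    · exact h.1.le
  have hpers : f ∈ persistent I := by
    constructor
    · rw [mem_mingens_iff]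
      refine ⟨hf, fun a ha h => ?_, fun a ha h => ?_⟩
      · have := hle _ h
        simp only [← ha] at this
        nlinarith
      · have := hle _ h
        simp only [← ha] at this
        nlinarith
    · rintro q r hq hr hqf hrf ⟨n, hn, hmem⟩
      rw [← mon_nsmul, mem_pow_monIdeal_pair] at hmem
      obtain ⟨s, t, rfl, hst⟩ := hmem
      have hgt : ∀ q, mon 𝕜 q ∈ I → q ≠ f → v * f.1 + u * f.2 < v * q.1 + u * q.2 ∨
          v * f.1 + u * f.2 = v * q.1 + u * q.2 ∧ f.1 < q.1 := by
        intro q hq hqf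
        rcases hmin' q hq with h | ⟨h, h'⟩
        · exact Or.inl h
        · refine Or.inr ⟨h, lt_of_le_of_ne h' fun h'' => hqf ?_⟩
          rw [h''] at h
          exact Prod.ext h''.symm (Nat.eq_of_mul_eq_mul_left hu0 (by omega))
      have e1 := hst.1
      have e2 := hst.2
      simp only [Prod.smul_fst, Prod.smul_snd, Prod.fst_add, Prod.snd_add, smul_eq_mul] at e1 e2
      -- As `f` minimises the form, every factor in actual use has the same value as `f`; the
      -- tie-break then gives it larger x-degree, contradicting `e1`.
      have e3 : s * (v * q.1 + u * q.2) + t * (v * r.1 + u * r.2) ≤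
          (s + t) * (v * f.1 + u * f.2) := by nlinarith
      have hs := Nat.mul_le_mul_left s (hle q hq)
      have ht := Nat.mul_le_mul_left t (hle r hr)
      have hs1 : s * f.1 ≤ s * q.1 ∧ (0 < s → s * f.1 < s * q.1) := by
        rcases hgt q hq hqf with h | h
        · have : s = 0 := by
            by_contra h0
            have := Nat.mul_lt_mul_of_pos_left h (Nat.pos_of_ne_zero h0)
            nlinarith
          simp [this]
        · exact ⟨Nat.mul_le_mul_left _ h.2.le, fun h0 => Nat.mul_lt_mul_of_pos_left h.2 h0⟩
      have ht1 : t * f.1 ≤ t * r.1 ∧ (0 < t → t * f.1 < t * r.1) := by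
        rcases hgt r hr hrf with h | h
        · have : t = 0 := by
            by_contra h0
            have := Nat.mul_lt_mul_of_pos_left h (Nat.pos_of_ne_zero h0)
            nlinarith
          simp [this]
        · exact ⟨Nat.mul_le_mul_left _ h.2.le, fun h0 => Nat.mul_lt_mul_of_pos_left h.2 h0⟩
      rw [add_mul] at e1
      rcases Nat.eq_zero_or_pos s with h | h
      · have := ht1.2 (by omega); omega
      · have := hs1.2 h; omega
  obtain ⟨m, hm, rfl⟩ := C.persistent_subset hpers
  exact (C.line_le_chain h1 hi hu hv hm.1 hm.2).trans (hle e he)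

end PersistentChain

end Decomposition

/-! ### Powers of I as sums of bands: the exchange argument. -/

section Decomposition

variable {𝕜 : Type*} [Field 𝕜]

/-- Only powers of y divide a power of y, and those in the ideal other than the generator have
larger degree. With its counterpart for x this fixes the two ends of the chain. -/
lemma pure_y_persistent {I : Ideal (Poly 𝕜)} {b : ℕ} (hb : (0, b) ∈ mingens I) :
    (0, b) ∈ persistent I := by
  refine ⟨hb, ?_⟩
  rintro q r hq hr hqf hrf ⟨n, hn, hmem⟩
  rw [← mon_nsmul, mem_pow_monIdeal_pair] at hmem
  obtain ⟨s, t, rfl, hst⟩ := hmem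
  have e1 := hst.1
  have e2 := hst.2
  simp only [Prod.smul_fst, Prod.smul_snd, Prod.fst_add, Prod.snd_add, smul_eq_mul, mul_zero,
    nonpos_iff_eq_zero, Nat.add_eq_zero_iff, mul_eq_zero] at e1 e2
  have key : ∀ q, mon 𝕜 q ∈ I → q ≠ (0, b) → q.1 = 0 → b < q.2 := by
    intro q hq hqf h0
    by_contra! h
    exact hqf (eq_of_le_mingens hb hq ⟨h0.le, h⟩)
  have hs : s * b ≤ s * q.2 ∧ (0 < s → s * b < s * q.2) := by
    rcases e1.1 with rfl | h
    · simp
    · have := key q hq hqf h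
      exact ⟨Nat.mul_le_mul_left _ this.le, fun h0 => Nat.mul_lt_mul_of_pos_left this h0⟩
  have ht : t * b ≤ t * r.2 ∧ (0 < t → t * b < t * r.2) := by
    rcases e1.2 with rfl | h
    · simp
    · have := key r hr hrf h
      exact ⟨Nat.mul_le_mul_left _ this.le, fun h0 => Nat.mul_lt_mul_of_pos_left this h0⟩
  rw [add_mul] at e2
  rcases Nat.eq_zero_or_pos s with h | h
  · have := ht.2 (by omega); omega
  · have := hs.2 h; omega

lemma pure_x_persistent {I : Ideal (Poly 𝕜)} {a : ℕ} (ha : (a, 0) ∈ mingens I) :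
    (a, 0) ∈ persistent I := by
  refine ⟨ha, ?_⟩
  rintro q r hq hr hqf hrf ⟨n, hn, hmem⟩
  rw [← mon_nsmul, mem_pow_monIdeal_pair] at hmem
  obtain ⟨s, t, rfl, hst⟩ := hmem
  have e1 := hst.1
  have e2 := hst.2
  simp only [Prod.smul_fst, Prod.smul_snd, Prod.fst_add, Prod.snd_add, smul_eq_mul, mul_zero,
    nonpos_iff_eq_zero, Nat.add_eq_zero_iff, mul_eq_zero] at e1 e2
  have key : ∀ q, mon 𝕜 q ∈ I → q ≠ (a, 0) → q.2 = 0 → a < q.1 := by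
    intro q hq hqf h0
    by_contra! h
    exact hqf (eq_of_le_mingens ha hq ⟨h, h0.le⟩)
  have hs : s * a ≤ s * q.1 ∧ (0 < s → s * a < s * q.1) := by
    rcases e2.1 with rfl | h
    · simp
    · have := key q hq hqf h
      exact ⟨Nat.mul_le_mul_left _ this.le, fun h0 => Nat.mul_lt_mul_of_pos_left this h0⟩
  have ht : t * a ≤ t * r.1 ∧ (0 < t → t * a < t * r.1) := by
    rcases e2.2 with rfl | h
    · simp
    · have := key r hr hrf h
      exact ⟨Nat.mul_le_mul_left _ this.le, fun h0 => Nat.mul_lt_mul_of_pos_left this h0⟩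
  rw [add_mul] at e1
  rcases Nat.eq_zero_or_pos s with h | h
  · have := ht.2 (by omega); omega
  · have := hs.2 h; omega

/-- A multiset of `n` generators of `I` whose sum divides `e`, minimal with respect to replacing
a part of it by generators with a smaller sum. -/
lemma exists_minimal_factorization {I : Ideal (Poly 𝕜)} (hI : IsMonomialIdeal I) (n : ℕ)
    {e : ℕ × ℕ} (he : mon 𝕜 e ∈ I ^ n) (φ ψ : ℕ × ℕ → ℕ) :
    ∃ M : Multiset (ℕ × ℕ), M.card = n ∧ (∀ f ∈ M, f ∈ mingens I) ∧ M.sum ≤ e ∧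
      ∀ Q Q' : Multiset (ℕ × ℕ), Q ≤ M → Q'.card = Q.card → (∀ f ∈ Q', f ∈ mingens I) →
        Q'.sum ≤ Q.sum → (Q.map φ).sum < (Q'.map φ).sum ∨
          (Q.map φ).sum = (Q'.map φ).sum ∧ (Q.map ψ).sum ≤ (Q'.map ψ).sum := by
  obtain ⟨M₀, hM₀⟩ := hI.mon_mem_pow.1 he
  obtain ⟨M, hM, hmin⟩ := WellFounded.has_min
    (InvImage.wf (fun M : Multiset (ℕ × ℕ) => toLex ((M.map φ).sum, (M.map ψ).sum))
      wellFounded_lt)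
    {M | M.card = n ∧ (∀ f ∈ M, f ∈ mingens I) ∧ M.sum ≤ e} ⟨M₀, hM₀⟩
  obtain ⟨h1, h2, h3⟩ := hM
  refine ⟨M, h1, h2, h3, fun Q Q' hQ hcard hQ' hsum => ?_⟩
  -- Both weights are additive, so the untouched rest `R` cancels and minimality of the whole passes
  -- to the part `Q`.
  obtain ⟨R, rfl⟩ := Multiset.le_iff_exists_add.1 hQ
  have := hmin (Q' + R) ⟨by simpa [hcard] using h1, fun f hf => by
    rcases Multiset.mem_add.1 hf with h | h
    · exact hQ' f h
    · exact h2 f (Multiset.mem_add.2 (Or.inr h)), by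
    rw [Multiset.sum_add] at h3 ⊢
    exact (add_le_add_left hsum _).trans h3⟩
  rw [InvImage, not_lt, Prod.Lex.toLex_le_toLex] at this
  simp only [Multiset.map_add, Multiset.sum_add] at this
  omega

namespace PersistentChain

variable {I : Ideal (Poly 𝕜)} {k : ℕ} {g : ℕ → ℕ × ℕ} (C : PersistentChain I k g)
include C

lemma first_eq {b : ℕ} (hb : (0, b) ∈ mingens I) : g 1 = (0, b) := by
  obtain ⟨m, ⟨hm1, hm2⟩, hm⟩ := C.persistent_subset (pure_y_persistent hb)
  have := C.fst_le le_rfl hm1 hm2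
  have h2 := C.snd_le le_rfl hm1 hm2
  rw [hm] at this h2
  have := eq_of_le_mingens (C.mem_mingens le_rfl (by omega)) hb.1 ?_
  · exact this.symm
  · refine ⟨?_, h2⟩
    simp

lemma last_eq {a : ℕ} (ha : (a, 0) ∈ mingens I) : g (k + 1) = (a, 0) := by
  obtain ⟨m, ⟨hm1, hm2⟩, hm⟩ := C.persistent_subset (pure_x_persistent ha)
  have := C.fst_le hm1 hm2 le_rfl
  rw [hm] at this
  exact (eq_of_le_mingens (C.mem_mingens (by omega) le_rfl) ha.1 ⟨this, by simp⟩).symm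

/-- A generator outside the chain has a small power in a power of the ideal of two neighbours. -/
lemma exists_replacement {b a : ℕ} (hb : (0, b) ∈ mingens I) (ha : (a, 0) ∈ mingens I)
    {f : ℕ × ℕ} (hf : f ∈ mingens I) (hfP : f ∉ g '' Set.Icc 1 (k + 1)) :
    ∃ i, 1 ≤ i ∧ i ≤ k ∧ ∃ s t, 1 ≤ s + t ∧
      s + t = min ((g (i + 1)).1 - (g i).1) ((g i).2 - (g (i + 1)).2) ∧
      s • g i + t • g (i + 1) ≤ (s + t) • f := by
  have hne : ∀ j, 1 ≤ j → j ≤ k + 1 → f.2 ≠ (g j).2 := fun j h1 h2 h =>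
    hfP ⟨j, ⟨h1, h2⟩, (mingens_ext_snd hf (C.mem_mingens h1 h2) h).symm⟩
  have hfirst : f.2 < (g 1).2 := by
    refine lt_of_le_of_ne ?_ (hne 1 le_rfl (by omega))
    by_contra! h
    rw [C.first_eq hb] at h
    have := fst_lt_of_snd_lt hb.1 hf h
    simp at this
  -- The least such index places `f` strictly between `g i` and `g (i + 1)`.
  have hex : ∃ i, 1 ≤ i ∧ (g (i + 1)).2 ≤ f.2 := by
    refine ⟨k, ?_, by rw [C.last_eq ha]; simp⟩
    rcases Nat.eq_zero_or_pos k with rfl | h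
    · have := C.last_eq ha
      rw [zero_add] at this
      rw [this] at hfirst
      simp at hfirst
    · exact h
  classical
  obtain ⟨hi1, hi2⟩ := Nat.find_spec hex
  have hik : Nat.find hex ≤ k := by
    refine Nat.find_min' hex ⟨?_, by rw [C.last_eq ha]; simp⟩
    rcases Nat.eq_zero_or_pos k with rfl | h
    · have := C.last_eq ha
      rw [zero_add] at this
      rw [this] at hfirst
      simp at hfirst
    · exact h
  have hi3 : f.2 < (g (Nat.find hex)).2 := by
    rcases hi1.eq_or_lt with h | h
    · rw [← h]; exact hfirst
    · have := Nat.find_min hex (m := Nat.find hex - 1) (by omega)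
      rw [Nat.sub_add_cancel hi1] at this
      have h' : ¬ (g (Nat.find hex)).2 ≤ f.2 := fun h'' => this ⟨by omega, h''⟩
      omega
  generalize Nat.find hex = i at hi1 hi2 hik hi3
  have hi2 : (g (i + 1)).2 < f.2 := lt_of_le_of_ne hi2 (hne _ (by omega) (by omega)).symm
  have hx1 := fst_lt_of_snd_lt hf.1 (C.mem_mingens hi1 (by omega)) hi3
  have hx2 := fst_lt_of_snd_lt (C.mem_mingens (i := i + 1) (by omega) (by omega)).1 hf hi2
  obtain ⟨p, hp⟩ := exists_add_of_le hx1.le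
  obtain ⟨p', hp'⟩ := exists_add_of_le hx2.le
  obtain ⟨q, hq⟩ := exists_add_of_le hi2.le
  obtain ⟨q', hq'⟩ := exists_add_of_le hi3.le
  have hline := C.line_le hi1 hik (u := p + p') (v := q + q') (by omega) (by omega) hf.1
  refine ⟨i, hi1, hik, ?_⟩
  have hu : (g (i + 1)).1 - (g i).1 = p + p' := by omega
  have hv : (g i).2 - (g (i + 1)).2 = q + q' := by omega
  rw [hu, hv]
  -- Interpolation takes place in the coordinate with the smaller distance: the weights match the
  -- degree of `f` there, and `line_le` gives the inequality in the other coordinate.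
  rcases le_total (p + p') (q + q') with h | h
  · refine ⟨p', p, by omega, by omega, ?_, ?_⟩ <;>
    simp only [Prod.smul_fst, Prod.smul_snd, Prod.fst_add, Prod.snd_add, smul_eq_mul]
    · rw [hp', hp]; nlinarith
    · rw [hq', hq, hp] at hline
      rw [hq', hq]
      nlinarith
  · refine ⟨q, q', by omega, by omega, ?_, ?_⟩ <;>
    simp only [Prod.smul_fst, Prod.smul_snd, Prod.fst_add, Prod.snd_add, smul_eq_mul]
    · rw [hq', hq, hp] at hline
      rw [hp', hp]
      nlinarith
    · rw [hq', hq]; nlinarith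

/-- Two members of the chain that are not neighbours can be traded for one in between. -/
lemma exists_trade {b a d : ℕ} (hb : (0, b) ∈ mingens I) (ha : (a, 0) ∈ mingens I)
    (hd : min a b ≤ d + 2) :
    ∃ ψ : ℕ × ℕ → ℕ, ∀ i j l, 1 ≤ i → i < j → j < l → l ≤ k + 1 → ∃ p q, 1 ≤ p ∧ 1 ≤ q ∧
      p ≤ d + 1 ∧ q ≤ d + 1 ∧ (p + q) • g j ≤ q • g i + p • g l ∧
      (p + q) * ψ (g j) < q * ψ (g i) + p * ψ (g l) := by
  -- The square of a coordinate is a strictly convex potential, and the trade lowers it by pq(p +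
  -- q). In the coordinate with the smaller range, p + q ≤ min a b with p, q ≥ 1, so both are at
  -- most d + 1.
  rcases le_total a b with h | h
  · refine ⟨fun e => e.1 ^ 2, fun i j l h1 hij hjl hl => ?_⟩
    obtain ⟨p, hp⟩ := exists_add_of_le (C.fst_lt h1 hij (by omega)).le
    obtain ⟨q, hq⟩ := exists_add_of_le (C.fst_lt (by omega) hjl hl).le
    have hp0 := C.fst_lt h1 hij (by omega)
    have hq0 := C.fst_lt (by omega) hjl hl
    have hla := C.fst_le (by omega) hl le_rfl
    rw [C.last_eq ha] at hla
    simp only at hla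
    refine ⟨p, q, by omega, by omega, by omega, by omega, C.below_of_fst h1 hij hjl hl hp hq, ?_⟩
    have : 0 < p * q * (p + q) := by
      have : 0 < p := by omega
      have : 0 < q := by omega
      positivity
    simp only [hq, hp]
    nlinarith
  · refine ⟨fun e => e.2 ^ 2, fun i j l h1 hij hjl hl => ?_⟩
    have hp0 := C.snd_lt i j h1 hij (by omega)
    have hq0 := C.snd_lt j l (by omega) hjl hl
    obtain ⟨p, hp⟩ := exists_add_of_le hp0.le
    obtain ⟨q, hq⟩ := exists_add_of_le hq0.le
    have hla := C.snd_le le_rfl h1 (by omega)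
    rw [C.first_eq hb] at hla
    simp only at hla
    refine ⟨p, q, by omega, by omega, by omega, by omega, C.below_of_snd h1 hij hjl hl hp hq, ?_⟩
    have : 0 < p * q * (p + q) := by
      have : 0 < p := by omega
      have : 0 < q := by omega
      positivity
    simp only [hq, hp]
    nlinarith

/-- Every monomial of a high power of `I` is divisible by a product of many factors `g i` and
`g (i + 1)`, for some `i`. -/
theorem exists_decomposition {b a d δ D N : ℕ} (hb : (0, b) ∈ mingens I)
    (ha : (a, 0) ∈ mingens I) (hk : 1 ≤ k)
    (hδ : ∀ i, 1 ≤ i → i ≤ k → min ((g (i + 1)).1 - (g i).1) ((g i).2 - (g (i + 1)).2) ≤ δ + 1)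
    (hd : 1 < k → min a b ≤ d + 2) (hD : (mu I - (k + 1)) * δ + (k + 1) * d ≤ D)
    {e : ℕ × ℕ} (he : mon 𝕜 e ∈ I ^ (N + D)) :
    ∃ i, 1 ≤ i ∧ i ≤ k ∧ ∃ s t, s + t = N ∧ ∃ w, mon 𝕜 w ∈ I ^ D ∧
      s • g i + t • g (i + 1) + w ≤ e := by
  classical
  obtain ⟨ψ, hψ⟩ : ∃ ψ : ℕ × ℕ → ℕ, ∀ i j l, 1 ≤ i → i < j → j < l → l ≤ k + 1 →
      ∃ p q, 1 ≤ p ∧ 1 ≤ q ∧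
      p ≤ d + 1 ∧ q ≤ d + 1 ∧ (p + q) • g j ≤ q • g i + p • g l ∧
      (p + q) * ψ (g j) < q * ψ (g i) + p * ψ (g l) := by
    rcases hk.eq_or_lt with rfl | hk
    · exact ⟨fun _ => 0, fun i j l h1 h2 h3 h4 => by omega⟩
    · exact C.exists_trade hb ha (hd hk)
  set P : Finset (ℕ × ℕ) := (Finset.Icc 1 (k + 1)).image g with hPdef
  have hinj : Set.InjOn g (Finset.Icc 1 (k + 1) : Set ℕ) := by
    intro i hi j hj hij
    simp only [Finset.coe_Icc, Set.mem_Icc] at hi hj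
    rcases lt_trichotomy i j with h | h | h
    · have := C.snd_lt i j hi.1 h hj.2
      rw [hij] at this; omega
    · exact h
    · have := C.snd_lt j i hj.1 h hi.2
      rw [hij] at this; omega
  have hmemP : ∀ j, 1 ≤ j → j ≤ k + 1 → g j ∈ P := fun j h1 h2 =>
    Finset.mem_image_of_mem _ (Finset.mem_Icc.2 ⟨h1, h2⟩)
  have hPcard : P.card = k + 1 := by
    rw [hPdef, Finset.card_image_of_injOn hinj]; simp
  have hfin : (mingens I).Finite := by
    refine (Set.finite_Iic (a, b)).subset fun f hf => ⟨?_, ?_⟩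
    · by_contra! h
      have := snd_lt_of_fst_lt ha.1 hf h
      simp at this
    · by_contra! h
      have := fst_lt_of_snd_lt hb.1 hf h
      simp at this
  have hPsub : P ⊆ hfin.toFinset := by
    intro f hf
    obtain ⟨j, hj, rfl⟩ := Finset.mem_image.1 hf
    rw [Finset.mem_Icc] at hj
    exact hfin.mem_toFinset.2 (C.mem_mingens hj.1 hj.2)
  obtain ⟨M, hMc, hMI, hMe, hmin⟩ := exists_minimal_factorization C.isMonomial _ he
    (fun f => if f ∈ P then 0 else 1) ψ
  have hmap : ∀ (s t i j : ℕ) (χ : ℕ × ℕ → ℕ), ((Multiset.replicate s (g i) +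
      Multiset.replicate t (g j)).map χ).sum = s * χ (g i) + t * χ (g j) := by
    intros; simp
  have hsum : ∀ (s t i j : ℕ), (Multiset.replicate s (g i) +
      Multiset.replicate t (g j)).sum = s • g i + t • g j := by
    intros; simp [Multiset.sum_replicate]
  have hmem : ∀ (s t i j : ℕ), 1 ≤ i → i ≤ k + 1 → 1 ≤ j → j ≤ k + 1 →
      ∀ f ∈ Multiset.replicate s (g i) + Multiset.replicate t (g j), f ∈ mingens I := by
    intro s t i j h1 h2 h3 h4 f hf
    rcases Multiset.mem_add.1 hf with h | h
    · rw [Multiset.eq_of_mem_replicate h]; exact C.mem_mingens h1 h2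
    · rw [Multiset.eq_of_mem_replicate h]; exact C.mem_mingens h3 h4
  have hle : ∀ (s t i j : ℕ), 1 ≤ i → i < j → j ≤ k + 1 → s ≤ M.count (g i) →
      t ≤ M.count (g j) → Multiset.replicate s (g i) + Multiset.replicate t (g j) ≤ M := by
    intro s t i j h1 hij hj hs ht
    have hne : g i ≠ g j := fun h => by
      have := C.snd_lt i j h1 hij hj
      rw [h] at this; omega
    rw [Multiset.le_iff_count]
    intro f
    rw [Multiset.count_add, Multiset.count_replicate, Multiset.count_replicate]
    by_cases h : g i = f
    · subst h
      simpa [hne.symm] using hs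
    · by_cases h' : g j = f
      · subst h'
        simpa [hne] using ht
      · simp [h, h']
  -- Otherwise min{u_i, v_i} ≤ δ + 1 copies of `f` could be replaced by members of the chain,
  -- lowering the first weight.
  have hout : ∀ f ∈ hfin.toFinset \ P, M.count f ≤ δ := by
    intro f hf
    rw [Finset.mem_sdiff, hfin.mem_toFinset] at hf
    obtain ⟨i, h1, hi, s, t, hst, hst', hle'⟩ := C.exists_replacement hb ha hf.1
      (by simpa [hPdef] using hf.2)
    by_contra! hlt
    have hst2 := hδ i h1 hi
    have := hmin (Multiset.replicate (s + t) f)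
      (Multiset.replicate s (g i) + Multiset.replicate t (g (i + 1)))
      (Multiset.le_count_iff_replicate_le.1 (by omega)) (by simp)
      (hmem _ _ _ _ h1 (by omega) (by omega) (by omega))
      (by rw [hsum, Multiset.sum_replicate]; exact hle')
    rw [hmap, if_pos (hmemP i h1 (by omega)), if_pos (hmemP (i + 1) (by omega) (by omega)),
      Multiset.map_replicate, Multiset.sum_replicate, if_neg hf.2] at this
    simp only [smul_eq_mul] at this
    omega
  -- Otherwise copies of both could be traded for `g (i + 1)`, which keeps the first weight and
  -- lowers `ψ`.
  have hpair : ∀ i l, 1 ≤ i → i + 1 < l → l ≤ k + 1 → M.count (g i) ≤ d ∨ M.count (g l) ≤ d := by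
    intro i l h1 hil hl
    by_contra! hlt
    obtain ⟨p, q, hp1, hq1, hp, hq, hpq, hpot⟩ := hψ i (i + 1) l h1 (by omega) hil hl
    have := hmin (Multiset.replicate q (g i) + Multiset.replicate p (g l))
      (Multiset.replicate p (g (i + 1)) + Multiset.replicate q (g (i + 1)))
      (hle _ _ _ _ h1 (by omega) hl (by omega) (by omega)) (by simp [add_comm])
      (hmem _ _ _ _ (by omega) (by omega) (by omega) (by omega))
      (by rw [hsum, hsum, ← add_nsmul]; exact hpq)
    rw [hmap, hmap, hmap, hmap, if_pos (hmemP i h1 (by omega)),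
      if_pos (hmemP (i + 1) (by omega) (by omega)), if_pos (hmemP l (by omega) hl),
      ← add_mul, ← add_mul] at this
    simp only [mul_zero, lt_irrefl, true_and, false_or] at this
    rw [add_mul] at hpot
    omega
  -- The least index with multiplicity above `d` works: `hpair` controls the later non-neighbours.
  -- If there is none up to `k`, the last pair works.
  obtain ⟨i, h1, hi, hother⟩ : ∃ i, 1 ≤ i ∧ i ≤ k ∧ ∀ j, 1 ≤ j → j ≤ k + 1 → j ≠ i → j ≠ i + 1 →
      M.count (g j) ≤ d := by
    by_cases hex : ∃ i, 1 ≤ i ∧ i ≤ k ∧ d < M.count (g i)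
    · obtain ⟨h1, hi, hi'⟩ := Nat.find_spec hex
      refine ⟨Nat.find hex, h1, hi, fun j hj1 hj hji hji' => ?_⟩
      rcases lt_or_gt_of_ne hji with h | h
      · by_contra! h'
        exact Nat.find_min hex h ⟨hj1, by omega, h'⟩
      · rcases hpair _ j h1 (by omega) hj with h' | h'
        · omega
        · exact h'
    · push Not at hex
      exact ⟨k, hk, le_rfl, fun j hj1 hj hjk hjk' => hex j hj1 (by omega)⟩
  -- Of the N + D factors at most (μ(I) - |P|)δ + |P|d ≤ D lie outside the pair.
  have hcount : N ≤ M.count (g i) + M.count (g (i + 1)) := by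
    have hcard : ∑ f ∈ hfin.toFinset, M.count f = N + D := by
      rw [← hMc]
      exact Multiset.sum_count_eq_card fun f hf => hfin.mem_toFinset.2 (hMI f hf)
    rw [← Finset.sum_sdiff hPsub] at hcard
    have hs1 : ∑ f ∈ hfin.toFinset \ P, M.count f ≤ (mu I - (k + 1)) * δ := by
      refine (Finset.sum_le_card_nsmul _ _ _ hout).trans (le_of_eq ?_)
      rw [Finset.card_sdiff_of_subset hPsub, hPcard, mu, Set.ncard_eq_toFinset_card _ hfin,
        smul_eq_mul]
    have hs2 : ∑ f ∈ P, M.count f ≤ (k + 1) * d + (M.count (g i) + M.count (g (i + 1))) := by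
      rw [hPdef, Finset.sum_image hinj]
      calc ∑ j ∈ Finset.Icc 1 (k + 1), M.count (g j)
          ≤ ∑ j ∈ Finset.Icc 1 (k + 1), (d + ((if j = i then M.count (g i) else 0) +
              if j = i + 1 then M.count (g (i + 1)) else 0)) := by
            refine Finset.sum_le_sum fun j hj => ?_
            rw [Finset.mem_Icc] at hj
            by_cases hji : j = i
            · subst hji; simp
            · by_cases hji' : j = i + 1
              · subst hji'; simp
              · simpa [hji, hji'] using hother j hj.1 hj.2 hji hji'
        _ = (k + 1) * d + (M.count (g i) + M.count (g (i + 1))) := by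
            rw [Finset.sum_add_distrib, Finset.sum_add_distrib, Finset.sum_ite_eq',
              Finset.sum_ite_eq', if_pos (Finset.mem_Icc.2 ⟨h1, by omega⟩),
              if_pos (Finset.mem_Icc.2 ⟨by omega, by omega⟩)]
            simp
    omega
  -- N factors from the pair are split off, `g i` as often as possible; the other D factors form the
  -- monomial of I^D.
  have hQ := hle (min (M.count (g i)) N) (N - min (M.count (g i)) N) i (i + 1) h1 (by omega)
    (by omega) (by omega) (by omega)
  obtain ⟨R, hR⟩ := Multiset.le_iff_exists_add.1 hQ
  refine ⟨i, h1, hi, min (M.count (g i)) N, N - min (M.count (g i)) N, by omega, R.sum, ?_, ?_⟩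
  · have hRc : R.card = D := by
      have := congrArg Multiset.card hR
      simp only [Multiset.card_add, Multiset.card_replicate] at this
      omega
    rw [← hRc]
    exact sum_mem_pow fun f hf => (hMI f (by rw [hR]; exact Multiset.mem_add.2 (Or.inr hf))).1
  · rw [← hsum, ← Multiset.sum_add, ← hR]
    exact hMe

end PersistentChain

end Decomposition

/-! ### Regions controlled by a single band, and cancellation of factors. -/

section Bands

variable {𝕜 : Type*} [Field 𝕜]

/-- `e` is divisible by an element of `(g i, g (i + 1)) ^ N * I ^ D`. -/
def InBand (I : Ideal (Poly 𝕜)) (g : ℕ → ℕ × ℕ) (D N i : ℕ) (e : ℕ × ℕ) : Prop :=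
  ∃ s t, s + t = N ∧ ∃ w, mon 𝕜 w ∈ I ^ D ∧ s • g i + t • g (i + 1) + w ≤ e

/-- A persistent chain running from a power of `y` to a power of `x`, such that `I ^ (N + D)` is the
sum of the ideals `(g i, g (i + 1)) ^ N * I ^ D` for all `N`; `y ^ B` is the minimal power of `y`
in `I ^ D`. -/
structure BandDecomposition (I : Ideal (Poly 𝕜)) (k : ℕ) (g : ℕ → ℕ × ℕ) (D B : ℕ) : Prop
    extends PersistentChain I k g where
  one_le : 1 ≤ k
  fst_first : (g 1).1 = 0
  snd_last : (g (k + 1)).2 = 0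
  pure_mem : mon 𝕜 (0, B) ∈ I ^ D
  le_of_pure_mem : ∀ y, mon 𝕜 (0, y) ∈ I ^ D → B ≤ y
  exists_pure_x : ∃ A, mon 𝕜 (A, 0) ∈ I ^ D
  exists_inBand : ∀ N e, mon 𝕜 e ∈ I ^ (N + D) → ∃ i, 1 ≤ i ∧ i ≤ k ∧ InBand I g D N i e

namespace BandDecomposition

variable {I : Ideal (Poly 𝕜)} {k : ℕ} {g : ℕ → ℕ × ℕ} {D B : ℕ}
  (C : BandDecomposition I k g D B)
include C

lemma mem {i : ℕ} (h1 : 1 ≤ i) (hk : i ≤ k + 1) : mon 𝕜 (g i) ∈ I := (C.mem_mingens h1 hk).1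

lemma exists_steps {i : ℕ} (h1 : 1 ≤ i) (hi : i ≤ k) : ∃ u v, 0 < u ∧ 0 < v ∧
    (g (i + 1)).1 = (g i).1 + u ∧ (g i).2 = (g (i + 1)).2 + v ∧
    pairX 𝕜 (g i) (g (i + 1)) = u ∧ pairY 𝕜 (g i) (g (i + 1)) = v := by
  have hx := C.fst_lt h1 (Nat.lt_succ_self i) (by omega)
  have hy := C.snd_lt i (i + 1) h1 (Nat.lt_succ_self i) (by omega)
  exact ⟨_, _, Nat.sub_pos_of_lt hx, Nat.sub_pos_of_lt hy, (Nat.add_sub_of_le hx.le).symm,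
    (Nat.add_sub_of_le hy.le).symm, pairX_eq hx hy, pairY_eq hx hy⟩

lemma mem_of_inBand {N i : ℕ} (h1 : 1 ≤ i) (hi : i ≤ k) {e : ℕ × ℕ} (h : InBand I g D N i e) :
    mon 𝕜 e ∈ I ^ (N + D) := by
  obtain ⟨s, t, rfl, w, hw, hle⟩ := h
  exact mon_mem_of_le (add_mem_pow (add_mem_pow (nsmul_mem_pow (C.mem h1 (by omega)) s)
    (nsmul_mem_pow (C.mem (by omega) (by omega)) t)) hw) hle

lemma mul_fst_le {N i m : ℕ} {e : ℕ × ℕ} (hm : 1 ≤ m) (hmi : m ≤ i) (hi : i ≤ k)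
    (h : InBand I g D N i e) : N * (g m).1 ≤ e.1 := by
  obtain ⟨s, t, rfl, w, hw, hle⟩ := h
  have h1 := Nat.mul_le_mul_left s (C.fst_le hm hmi (by omega))
  have h2 := Nat.mul_le_mul_left t (C.fst_le hm (hmi.trans (Nat.le_succ i)) (by omega))
  have := hle.1
  simp only [Prod.smul_fst, Prod.fst_add, smul_eq_mul] at this
  rw [add_mul]
  simp only [Nat.succ_eq_add_one] at h2
  omega

lemma mul_snd_le {N i m : ℕ} {e : ℕ × ℕ} (h1 : 1 ≤ i) (him : i < m) (hm : m ≤ k + 1)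
    (h : InBand I g D N i e) : N * (g m).2 ≤ e.2 := by
  obtain ⟨s, t, rfl, w, hw, hle⟩ := h
  have h1 := Nat.mul_le_mul_left s (C.snd_le h1 him.le hm)
  have h2 := Nat.mul_le_mul_left t (C.snd_le (by omega) (Nat.succ_le_of_lt him) hm)
  have := hle.2
  simp only [Prod.smul_snd, Prod.snd_add, smul_eq_mul] at this
  rw [add_mul]
  simp only [Nat.succ_eq_add_one] at h2
  omega

/-- Later bands lie to the right of g_(i+1)^N, so sufficient height makes g_(i+1)^N y^B a divisor.
-/
lemma inBand_of_lt {N i j : ℕ} {e : ℕ × ℕ} (h1 : 1 ≤ i) (hij : i < j) (hj : j ≤ k)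
    (h : InBand I g D N j e) (hy : N * (g (i + 1)).2 + B ≤ e.2) : InBand I g D N i e := by
  have := C.mul_fst_le (m := i + 1) (by omega) (by omega) hj h
  exact ⟨0, N, by omega, (0, B), C.pure_mem, by simp [this], by simpa using hy⟩

/-- If `e ∈ I ^ (N + 1 + D)` lies in the region where only the bands next to `g j` are relevant,
then the factor `g j` can be removed. -/
lemma exists_eq_add {N j : ℕ} {e : ℕ × ℕ} (h1 : 1 ≤ j) (hj : j ≤ k + 1)
    (hup : ∀ m, 1 ≤ m → m + 1 = j → e.2 < (N + 1) * (g m).2)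
    (hlow : j ≤ k → e.1 < (N + 1) * (g (j + 1)).1 ∨ N * (g (j + 1)).2 + B + (g j).2 ≤ e.2)
    (he : mon 𝕜 e ∈ I ^ (N + 1 + D)) : ∃ f, e = f + g j ∧ mon 𝕜 f ∈ I ^ (N + D) := by
  obtain ⟨i, hi1, hi, hb⟩ := C.exists_inBand _ _ he
  -- This far to the right, the height condition makes g_(j+1)^N · y^B · g_j a divisor of `e`.
  have hpast : j ≤ k → (N + 1) * (g (j + 1)).1 ≤ e.1 →
      ∃ f, e = f + g j ∧ mon 𝕜 f ∈ I ^ (N + D) := by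
    intro hjk hx
    have hy : N * (g (j + 1)).2 + B + (g j).2 ≤ e.2 := (hlow hjk).resolve_left (by omega)
    have hlt := C.fst_lt h1 (Nat.lt_succ_self j) (by omega)
    obtain ⟨c, hc⟩ := exists_add_of_le (show N • g (j + 1) + (0, B) + g j ≤ e from
      ⟨by simp only [Prod.fst_add, Prod.smul_fst, smul_eq_mul]
          rw [add_mul] at hx; simp only [Nat.succ_eq_add_one] at hlt; omega,
        by simpa using hy⟩)
    refine ⟨N • g (j + 1) + (0, B) + c, by rw [hc]; abel, ?_⟩
    exact mon_mem_of_le (add_mem_pow (nsmul_mem_pow (C.mem (by omega) (by omega)) N) C.pure_mem)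
      le_self_add
  -- By `hup`, bands before j - 1 lie too high and band j - 1 must use `g j`. Band j uses `g j` or,
  -- like all later bands, falls under `hpast`.
  rcases lt_trichotomy (i + 1) j with h | rfl | h
  · exfalso
    obtain ⟨m, rfl⟩ : ∃ m, j = m + 1 := ⟨j - 1, by omega⟩
    have := C.mul_snd_le (m := m) hi1 (by omega) (by omega) hb
    have := hup m (by omega) rfl
    omega
  · obtain ⟨s, t, hst, w, hw, hle⟩ := hb
    rcases t with _ | t
    · exfalso
      have := hup i hi1 rfl
      have h2 := hle.2
      obtain rfl : s = N + 1 := by omega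
      simp only [Prod.smul_snd, Prod.snd_add, smul_eq_mul] at h2
      omega
    · obtain ⟨c, hc⟩ := exists_add_of_le hle
      refine ⟨s • g i + t • g (i + 1) + w + c, by rw [hc, succ_nsmul]; abel, ?_⟩
      obtain rfl : N = s + t := by omega
      exact C.mem_of_inBand hi1 hi ⟨s, t, rfl, w, hw, le_self_add⟩
  · rcases (show j ≤ i by omega).eq_or_lt with rfl | h'
    · by_cases hs : ∃ s t, (s + 1) + t = N + 1 ∧ ∃ w, mon 𝕜 w ∈ I ^ D ∧
        (s + 1) • g j + t • g (j + 1) + w ≤ e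
      · obtain ⟨s, t, hst, w, hw, hle⟩ := hs
        obtain ⟨c, hc⟩ := exists_add_of_le hle
        refine ⟨s • g j + t • g (j + 1) + w + c, by rw [hc, succ_nsmul]; abel, ?_⟩
        obtain rfl : N = s + t := by omega
        exact C.mem_of_inBand hi1 hi ⟨s, t, rfl, w, hw, le_self_add⟩
      · obtain ⟨s, t, hst, w, hw, hle⟩ := hb
        rcases s with _ | s
        · refine hpast hi ?_
          have h2 := hle.1
          obtain rfl : t = N + 1 := by omega
          simp only [Prod.smul_fst, Prod.fst_add, smul_eq_mul] at h2
          omega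
        · exact absurd ⟨s, t, hst, w, hw, hle⟩ hs
    · exact hpast (by omega) (C.mul_fst_le (by omega) (by omega) hi hb)

/-- The bounds involve `l * g j` so that removing one factor turns them into the bounds for `l - 1`.
-/
lemma exists_eq_add_nsmul {N l j : ℕ} {e : ℕ × ℕ} (h1 : 1 ≤ j) (hj : j ≤ k + 1)
    (hup : ∀ m, 1 ≤ m → m + 1 = j → e.2 + (g j).2 < (N + 1) * (g m).2 + l * (g j).2)
    (hlow : j ≤ k → e.1 + (g j).1 < (N + 1) * (g (j + 1)).1 + l * (g j).1 ∨
      N * (g (j + 1)).2 + B + l * (g j).2 ≤ e.2)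
    (he : mon 𝕜 e ∈ I ^ (N + l + D)) : ∃ f, e = f + l • g j ∧ mon 𝕜 f ∈ I ^ (N + D) := by
  induction l generalizing e with
  | zero => exact ⟨e, by simp, he⟩
  | succ l ih =>
    have hup' : ∀ m, 1 ≤ m → m + 1 = j → e.2 < (N + l + 1) * (g m).2 := by
      intro m hm hmj
      have h := hup m hm hmj
      have h2 := Nat.mul_le_mul_left l (C.snd_le hm (by omega : m ≤ j) hj)
      simp only [add_mul] at h ⊢
      omega
    have hlow' : j ≤ k → e.1 < (N + l + 1) * (g (j + 1)).1 ∨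
        (N + l) * (g (j + 1)).2 + B + (g j).2 ≤ e.2 := by
      intro hjk
      have h2 := Nat.mul_le_mul_left l (C.snd_le h1 (Nat.le_succ j) (by omega))
      have h3 := Nat.mul_le_mul_left l (C.fst_le h1 (Nat.le_succ j) (by omega))
      simp only [Nat.succ_eq_add_one] at h2 h3
      refine (hlow hjk).imp (fun h => ?_) fun h => ?_
      · simp only [add_mul] at h ⊢
        omega
      · simp only [add_mul] at h ⊢
        omega
    obtain ⟨f, rfl, hf⟩ := C.exists_eq_add h1 hj hup' hlow' he
    obtain ⟨f', rfl, hf'⟩ := ih (e := f)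
      (fun m hm hmj => by
        have := hup m hm hmj
        simp only [Prod.snd_add, add_mul] at this ⊢
        omega)
      (fun hjk => (hlow hjk).imp
        (fun h => by simp only [Prod.fst_add, add_mul] at h ⊢; omega)
        (fun h => by simp only [Prod.snd_add, add_mul] at h ⊢; omega)) hf
    exact ⟨f', by rw [succ_nsmul, add_assoc], hf'⟩

/-- In this region multiplication by powers of `g j` creates no new monomials; this is the source of
the independence of ℓ. -/
lemma mem_of_add_nsmul_mem {N j : ℕ} {f : ℕ × ℕ} (h1 : 1 ≤ j) (hj : j ≤ k + 1)
    (hup : ∀ m, 1 ≤ m → m + 1 = j → f.2 + (g j).2 < (N + 1) * (g m).2)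
    (hlow : j ≤ k → N * (g (j + 1)).2 + B ≤ f.2)
    {l : ℕ} (hf : mon 𝕜 (f + l • g j) ∈ I ^ (N + l + D)) : mon 𝕜 f ∈ I ^ (N + D) := by
  obtain ⟨f', hf', h⟩ := C.exists_eq_add_nsmul h1 hj
    (fun m hm hmj => by
      have := hup m hm hmj
      simp only [Prod.snd_add, Prod.smul_snd, smul_eq_mul]
      omega)
    (fun hjk => Or.inr (by
      have := hlow hjk
      simp only [Prod.snd_add, Prod.smul_snd, smul_eq_mul]
      omega)) hf
  rw [add_left_inj] at hf'
  rwa [hf']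

/-- In the lower part of the `i`-th band, a factor `g i` can be traded for `g (i + 1)`. -/
lemma exists_swap_down {N i : ℕ} {e : ℕ × ℕ} (h1 : 1 ≤ i) (hi : i ≤ k)
    (hup : e.2 + (g (i + 1)).2 < (N + 1) * (g i).2)
    (hlow : N * (g (i + 1)).2 + B + (g i).2 ≤ e.2 + (g (i + 1)).2)
    (he : mon 𝕜 e ∈ I ^ (N + D)) : ∃ f, e + g (i + 1) = f + g i ∧ mon 𝕜 f ∈ I ^ (N + D) := by
  refine C.exists_eq_add h1 (by omega) (fun m hm hmi => ?_) (fun _ => Or.inr ?_) ?_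
  · refine hup.trans_le (Nat.mul_le_mul_left _ (C.snd_le hm (by omega) (by omega)))
  · simpa using hlow
  · have := add_mem_pow he (nsmul_mem_pow (C.mem (i := i + 1) (by omega) (by omega)) 1)
    rw [one_nsmul] at this
    rwa [show N + 1 + D = N + D + 1 by omega]

/-- Between the lower end of the `i`-th band and `N • g i`, the power of `I` is the `i`-th band. -/
lemma inBand_of_mem {N i : ℕ} {e : ℕ × ℕ} (hN : 1 ≤ N) (h1 : 1 ≤ i) (hi : i ≤ k)
    (hup : e.2 < N * (g i).2)
    (hlow : N * (g (i + 1)).2 + B ≤ e.2 ∨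
      e.1 ≤ N * (g (i + 1)).1 ∧ N * (g (i + 1)).2 + B ≤ e.2 + 1)
    (he : mon 𝕜 e ∈ I ^ (N + D)) : InBand I g D N i e := by
  obtain ⟨j, hj1, hj, hb⟩ := C.exists_inBand _ _ he
  rcases lt_trichotomy j i with h | rfl | h
  · have := C.mul_snd_le hj1 h (by omega) hb
    omega
  · exact hb
  · refine C.inBand_of_lt h1 h hj hb ?_
    rcases hlow with hlow | ⟨hx, hlow⟩
    · exact hlow
    -- One unit below the generic bound, the small x-degree confines `e` to band i + 1 and forces
    -- the factorization g_(i+1)^N times a power of y. That power is at least y^B, which recovers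
    -- the missing unit.
    · have hji : j = i + 1 := by
        by_contra hne
        have h2 := C.mul_fst_le (m := i + 2) (by omega) (by omega) hj hb
        have h3 := C.fst_lt (i := i + 1) (j := i + 2) (by omega) (by omega) (by omega)
        have := Nat.mul_lt_mul_of_pos_left h3 hN
        omega
      subst hji
      obtain ⟨s, t, hst, w, hw, hle⟩ := hb
      have hle1 := hle.1
      have hle2 := hle.2
      have h3 := C.fst_lt (i := i + 1) (j := i + 2) (by omega) (by omega) (by omega)
      obtain ⟨z, hz⟩ := exists_add_of_le h3.le
      simp only [Prod.smul_fst, Prod.smul_snd, Prod.fst_add, Prod.snd_add, smul_eq_mul] at hle1 hle2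
      rw [show i + 1 + 1 = i + 2 from rfl, hz, mul_add] at hle1
      have h4 : N * (g (i + 1)).1 = s * (g (i + 1)).1 + t * (g (i + 1)).1 := by rw [← hst, add_mul]
      have h5 : t * z = 0 := by omega
      have ht : t = 0 := by
        rcases Nat.mul_eq_zero.1 h5 with h | h
        · exact h
        · omega
      have hs : s = N := by omega
      have hw0 : w.1 = 0 := by omega
      have := C.le_of_pure_mem w.2 (by rw [← hw0]; exact hw)
      subst hs ht
      omega

end BandDecomposition

end Bands

/-! ### Segments of a band and the cut point. -/

section Segments

variable {𝕜 : Type*} [Field 𝕜]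

/-- The point `p` at which the `i`-th band is cut into its `r`-segments, together with the
distances `u` and `v` of `g i` and `g (i + 1)`. -/
structure IsSegmentPoint (I : Ideal (Poly 𝕜)) (k : ℕ) (g : ℕ → ℕ × ℕ) (D B r i u v : ℕ)
    (p : ℕ × ℕ) : Prop where
  one_le : 1 ≤ i
  le : i ≤ k
  u_pos : 0 < u
  v_pos : 0 < v
  fst_eq : (g (i + 1)).1 = (g i).1 + u
  snd_eq : (g i).2 = (g (i + 1)).2 + v
  pairX_eq : pairX 𝕜 (g i) (g (i + 1)) = u
  pairY_eq : pairY 𝕜 (g i) (g (i + 1)) = v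
  bound_le : B ≤ r * v
  mem_mingens : p ∈ mingens (segIdeal (g i) (g (i + 1)) (I ^ D) r)
  le_snd : r * v ≤ p.2
  snd_lt : p.2 < (r + 1) * v
  snd_le : ∀ f ∈ mingens (segIdeal (g i) (g (i + 1)) (I ^ D) r), r * v ≤ f.2 → p.2 ≤ f.2

/-- The common divisor `gcd(g i, g (i + 1)) ^ (r + 1)` of the `i`-th band. -/
def corner (g : ℕ → ℕ × ℕ) (r i : ℕ) : ℕ × ℕ := ((r + 1) * (g i).1, (r + 1) * (g (i + 1)).2)

@[simp] lemma corner_fst (g : ℕ → ℕ × ℕ) (r i : ℕ) : (corner g r i).1 = (r + 1) * (g i).1 := rfl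

@[simp] lemma corner_snd (g : ℕ → ℕ × ℕ) (r i : ℕ) :
    (corner g r i).2 = (r + 1) * (g (i + 1)).2 := rfl

namespace IsSegmentPoint

variable {I : Ideal (Poly 𝕜)} {k : ℕ} {g : ℕ → ℕ × ℕ} {D B r i u v : ℕ} {p : ℕ × ℕ}
  (S : IsSegmentPoint I k g D B r i u v p)
include S

lemma segPoint_eq : segPoint (g i) (g (i + 1)) (I ^ D) r = p := by
  rw [segPoint, S.pairY_eq]
  exact lowestGen_eq S.mem_mingens S.le_snd S.snd_le

lemma fst_lt_of_mingens {m : ℕ × ℕ} (hm : m ∈ mingens (segIdeal (g i) (g (i + 1)) (I ^ D) r))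
    (h : m.2 < r * v) : p.1 < m.1 :=
  fst_lt_of_snd_lt hm.1 S.mem_mingens (h.trans_le S.le_snd)

lemma corner_add_mul : (corner g r i).1 + (r + 1) * u = (r + 1) * (g (i + 1)).1 ∧
    (corner g r i).2 + (r + 1) * v = (r + 1) * (g i).2 := by
  rw [corner_fst, corner_snd, S.fst_eq, S.snd_eq, mul_add, mul_add]
  exact ⟨rfl, rfl⟩

/-- The restriction to L may be dropped: generators lower than r v lie to the right of `p`, so their
multiples at the height of `p` or above are multiples of `p`. -/
lemma mon_mem_segA {e : ℕ × ℕ} : mon 𝕜 e ∈ segA (g i) (g (i + 1)) (I ^ D) r ↔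
    mon 𝕜 (e + (0, p.2)) ∈ segIdeal (g i) (g (i + 1)) (I ^ D) r := by
  rw [segA, mon_mem_colonMon, S.segPoint_eq, mon_mem_monIdeal]
  constructor
  · rintro ⟨f, hf, hle⟩
    exact mon_mem_of_le hf.1.1 hle
  · intro h
    obtain ⟨m, hm, hle⟩ := exists_mingens_le h
    rw [setL, S.pairY_eq]
    rcases lt_or_ge m.2 (r * v) with h | h
    · have := S.fst_lt_of_mingens hm h
      have h1 := hle.1
      refine ⟨p, ⟨S.mem_mingens, S.le_snd⟩, ?_, by simp⟩
      simp only [Prod.fst_add, add_zero] at h1 ⊢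
      omega
    · exact ⟨m, ⟨hm, h⟩, hle⟩

/-- Generators of height at least r v are no lower than `p`, so their multiples to the right of `p`
are multiples of `p`. -/
lemma mon_mem_segB {e : ℕ × ℕ} : mon 𝕜 e ∈ segB (g i) (g (i + 1)) (I ^ D) r ↔
    mon 𝕜 (e + (p.1, 0)) ∈ segIdeal (g i) (g (i + 1)) (I ^ D) r := by
  rw [segB, mon_mem_colonMon, S.segPoint_eq, mon_mem_monIdeal]
  constructor
  · rintro ⟨f, hf | rfl, hle⟩
    · exact mon_mem_of_le hf.1.1 hle
    · exact mon_mem_of_le S.mem_mingens.1 hle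
  · intro h
    obtain ⟨m, hm, hle⟩ := exists_mingens_le h
    rw [setR, S.pairY_eq]
    rcases lt_or_ge m.2 (r * v) with h | h
    · exact ⟨m, Or.inl ⟨hm, h⟩, hle⟩
    · have h1 := hle.2
      have := S.snd_le m hm h
      exact ⟨p, Or.inr rfl, by simp, this.trans h1⟩

end IsSegmentPoint

namespace BandDecomposition

variable {I : Ideal (Poly 𝕜)} {k : ℕ} {g : ℕ → ℕ × ℕ} {D B : ℕ}
  (C : BandDecomposition I k g D B)
include C

lemma mon_mem_segIdeal {r i u v : ℕ} (h1 : 1 ≤ i) (hi : i ≤ k)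
    (hu : (g (i + 1)).1 = (g i).1 + u) (hv : (g i).2 = (g (i + 1)).2 + v) {e : ℕ × ℕ} :
    mon 𝕜 e ∈ segIdeal (g i) (g (i + 1)) (I ^ D) r ↔ ∃ s t, s + t = r + 1 ∧
      ∃ w, mon 𝕜 w ∈ I ^ D ∧ t * u + w.1 ≤ e.1 ∧ s * v + w.2 ≤ e.2 := by
  rw [segIdeal, red_pair (C.fst_lt h1 (Nat.lt_succ_self i) (by omega))
    (C.snd_lt i (i + 1) h1 (Nat.lt_succ_self i) (by omega)),
    ((isMonomialIdeal_monIdeal _).pow _).mon_mem_mul (C.isMonomial.pow _)]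
  simp only [mem_pow_monIdeal_pair]
  rw [show (g i).2 - (g (i + 1)).2 = v by omega, show (g (i + 1)).1 - (g i).1 = u by omega]
  constructor
  · rintro ⟨a, w, ⟨s, t, hst, ha⟩, hw, hle⟩
    have h1 := ha.1
    have h2 := ha.2
    have h3 := hle.1
    have h4 := hle.2
    simp only [Prod.smul_fst, Prod.smul_snd, Prod.fst_add, Prod.snd_add, smul_eq_mul, mul_zero,
      zero_add, add_zero] at h1 h2 h3 h4
    exact ⟨s, t, hst, w, hw, by omega, by omega⟩
  · rintro ⟨s, t, hst, w, hw, hx, hy⟩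
    refine ⟨(t * u, s * v), w, ⟨s, t, hst, by simp⟩, hw, hx, hy⟩

lemma mon_mem_segIdeal_iff_inBand {r i : ℕ} (h1 : 1 ≤ i) (hi : i ≤ k) {e : ℕ × ℕ} :
    mon 𝕜 e ∈ segIdeal (g i) (g (i + 1)) (I ^ D) r ↔
      InBand I g D (r + 1) i (e + corner g r i) := by
  obtain ⟨u, v, -, -, hu, hv, -, -⟩ := C.exists_steps h1 hi
  rw [C.mon_mem_segIdeal h1 hi hu hv, InBand]
  refine exists_congr fun s => exists_congr fun t => and_congr_right fun hst =>
    exists_congr fun w => and_congr_right fun _ => ?_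
  rw [Prod.le_def]
  simp only [Prod.smul_fst, Prod.smul_snd, Prod.fst_add, Prod.snd_add, smul_eq_mul, corner_fst,
    corner_snd, hu, hv, ← hst, add_mul, mul_add]
  omega

lemma exists_isSegmentPoint {r i : ℕ} (h1 : 1 ≤ i) (hi : i ≤ k)
    (hr : B ≤ r * pairY 𝕜 (g i) (g (i + 1))) :
    ∃ u v p, IsSegmentPoint I k g D B r i u v p := by
  obtain ⟨u, v, hu0, hv0, hu, hv, hX, hY⟩ := C.exists_steps h1 hi
  have hK := fun e => C.mon_mem_segIdeal (r := r) (e := e) h1 hi hu hv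
  obtain ⟨A, hA⟩ := C.exists_pure_x
  -- The leftmost element at height (r + 1)v - 1 shows that M is nonempty: if its generator were
  -- lower than r v, trading x^u for y^v would give an element further left without exceeding that
  -- height.
  have hex : ∃ x, mon 𝕜 (x, (r + 1) * v - 1) ∈ segIdeal (g i) (g (i + 1)) (I ^ D) r :=
    ⟨(r + 1) * u + A, (hK _).2 ⟨0, r + 1, by omega, (A, 0), hA, by simp, by simp⟩⟩
  classical
  obtain ⟨m, hm, hle⟩ := exists_mingens_le (Nat.find_spec hex)
  have hmx : m.1 = Nat.find hex := le_antisymm hle.1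
    (Nat.find_min' hex (mon_mem_of_le hm.1 ⟨le_rfl, hle.2⟩))
  have hle2 : m.2 ≤ (r + 1) * v - 1 := hle.2
  have hpos : 0 < (r + 1) * v := Nat.mul_pos (Nat.succ_pos r) hv0
  have hmy : r * v ≤ m.2 := by
    by_contra! hlt
    obtain ⟨s, t, hst, w, hw, hx, hy⟩ := (hK _).1 hm.1
    rcases t with _ | t
    · obtain rfl : s = r + 1 := by omega
      omega
    · refine Nat.find_min hex (m := m.1 - u) ?_ ((hK _).2 ⟨s + 1, t, by omega, w, hw, ?_, ?_⟩) <;>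
      simp only [add_mul, one_mul] at * <;> omega
  obtain ⟨p, hp, hp1, hp2⟩ := exists_lowest_mingens ⟨m, hm, hmy⟩
  exact ⟨u, v, p, h1, hi, hu0, hv0, hu, hv, hX, hY, hY ▸ hr, hp, hp1,
    by have := hp2 m hm hmy; omega, hp2⟩

section

variable {r i u v : ℕ} {p : ℕ × ℕ} (S : IsSegmentPoint I k g D B r i u v p)
include S

/-- Below height (r + 1)v not all r + 1 factors can be y^v, so some x^u is available for exchange.
-/
lemma swap_up_segIdeal {e : ℕ × ℕ} (he : mon 𝕜 e ∈ segIdeal (g i) (g (i + 1)) (I ^ D) r)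
    (hy : e.2 < (r + 1) * v) :
    u ≤ e.1 ∧ mon 𝕜 (e.1 - u, e.2 + v) ∈ segIdeal (g i) (g (i + 1)) (I ^ D) r := by
  have hK := fun e => C.mon_mem_segIdeal (r := r) (e := e) S.one_le S.le S.fst_eq S.snd_eq
  obtain ⟨s, t, hst, w, hw, hx, hy'⟩ := (hK _).1 he
  rcases t with _ | t
  · obtain rfl : s = r + 1 := by omega
    omega
  · refine ⟨?_, (hK _).2 ⟨s + 1, t, by omega, w, hw, ?_, ?_⟩⟩ <;>
    simp only [add_mul, one_mul] at * <;> omega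

lemma u_le_fst : u ≤ p.1 := (C.swap_up_segIdeal S S.mem_mingens.1 S.snd_lt).1

lemma fst_le_mul : p.1 ≤ (r + 1) * u := by
  have hK := fun e => C.mon_mem_segIdeal (r := r) (e := e) S.one_le S.le S.fst_eq S.snd_eq
  obtain ⟨m, hm, hle⟩ := exists_mingens_le
    ((hK ((r + 1) * u, r * v)).2 ⟨0, r + 1, by omega, (0, B), C.pure_mem, by simp,
      by simpa using S.bound_le⟩)
  have hle1 := hle.1
  have hle2 := hle.2
  simp only at hle1 hle2
  rcases hle2.eq_or_lt with h | h
  · have := S.snd_le m hm h.ge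
    have : m = p := mingens_ext_snd hm S.mem_mingens (by have := S.le_snd; omega)
    rw [← this]; exact hle1
  · have := S.fst_lt_of_mingens hm h
    omega

lemma distX_segA : distX (segA (g i) (g (i + 1)) (I ^ D) r) = p.1 := by
  have hK := fun e => C.mon_mem_segIdeal (r := r) (e := e) S.one_le S.le S.fst_eq S.snd_eq
  refine distX_eq (b := (r + 1) * v + B) (mem_mingens_iff.2 ⟨?_, fun a ha h => ?_, ?_⟩) ?_
  · rw [S.mon_mem_segA]; simpa using S.mem_mingens.1
  · rw [S.mon_mem_segA] at h
    exact (mem_mingens_iff.1 S.mem_mingens).2.1 a ha (by simpa using h)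
  · simp
  · rw [S.mon_mem_segA]
    exact mon_mem_of_le ((hK (0, (r + 1) * v + B)).2 ⟨r + 1, 0, by omega, (0, B), C.pure_mem,
      by simp, by simp⟩) (by simp)

lemma distY_segB : distY (segB (g i) (g (i + 1)) (I ^ D) r) = p.2 := by
  have hK := fun e => C.mon_mem_segIdeal (r := r) (e := e) S.one_le S.le S.fst_eq S.snd_eq
  obtain ⟨A, hA⟩ := C.exists_pure_x
  refine distY_eq (a := (r + 1) * u + A) ?_ (mem_mingens_iff.2 ⟨?_, ?_, fun b hb h => ?_⟩)
  · rw [S.mon_mem_segB]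
    exact mon_mem_of_le ((hK ((r + 1) * u + A, 0)).2 ⟨0, r + 1, by omega, (A, 0), hA,
      by simp, by simp⟩) (by simp)
  · rw [S.mon_mem_segB]; simpa using S.mem_mingens.1
  · simp
  · rw [S.mon_mem_segB] at h
    exact (mem_mingens_iff.1 S.mem_mingens).2.2 b hb (by simpa using h)

lemma mon_mem_segIdeal_of_mem_pow {e : ℕ × ℕ} (hy : B ≤ e.2) (hy' : e.2 < (r + 1) * v)
    (he : mon 𝕜 (e + corner g r i) ∈ I ^ (r + 1 + D)) :
    mon 𝕜 e ∈ segIdeal (g i) (g (i + 1)) (I ^ D) r := by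
  have hc := S.corner_add_mul
  rw [C.mon_mem_segIdeal_iff_inBand S.one_le S.le]
  refine C.inBand_of_mem (by omega) S.one_le S.le ?_ (Or.inl ?_) he
  · rw [Prod.snd_add]; omega
  · rw [Prod.snd_add, corner_snd]; omega

lemma mem_pow_of_mem_segIdeal {e : ℕ × ℕ}
    (he : mon 𝕜 e ∈ segIdeal (g i) (g (i + 1)) (I ^ D) r) :
    mon 𝕜 (e + corner g r i) ∈ I ^ (r + 1 + D) :=
  C.mem_of_inBand S.one_le S.le ((C.mon_mem_segIdeal_iff_inBand S.one_le S.le).1 he)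

/-- The cut point remains a minimal generator after multiplication with powers of `g i` and
`g (i + 1)`. -/
lemma add_nsmul_mem_mingens (t m : ℕ) :
    p + corner g r i + t • g (i + 1) + m • g i ∈ mingens (I ^ (r + 1 + m + t + D)) := by
  have hc := S.corner_add_mul
  have h1 := S.one_le
  have hi := S.le
  have hle := S.le_snd
  have hlt := S.snd_lt
  have hB := S.bound_le
  have hu0 := S.u_pos
  have hv0 := S.v_pos
  have hxu := C.fst_le_mul S
  have hfe := S.fst_eq
  have hse := S.snd_eq
  have hcs := corner_snd g r i
  have hcf := corner_fst g r i
  have e1 : ∀ a, (r + 1 + 1) * a = (r + 1) * a + a := fun a => by ring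
  have e2 : ∀ a, (r + 1 + m + 1) * a = (r + 1) * a + m * a + a := fun a => by ring
  have e3 : ∀ a, (r + 1 + m) * a = (r + 1) * a + m * a := fun a => by ring
  -- The neighbours of the translated cut point that decide its minimality still lie where `g (i +
  -- 1)` and then `g i` can be cancelled, which reduces the question to `p`.
  have hdown : ∀ e : ℕ × ℕ, e.1 ≤ (p + corner g r i + t • g (i + 1) + m • g i).1 →
      (p + corner g r i + t • g (i + 1) + m • g i).2 ≤ e.2 + 1 →
      e.2 ≤ (p + corner g r i + t • g (i + 1) + m • g i).2 → mon 𝕜 e ∈ I ^ (r + 1 + m + t + D) →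
      ∃ q, e = q + m • g i + t • g (i + 1) ∧ mon 𝕜 q ∈ I ^ (r + 1 + D) := by
    intro e he1 he2 he3 he
    simp only [Prod.fst_add, Prod.snd_add, Prod.smul_fst, Prod.smul_snd, smul_eq_mul]
      at he1 he2 he3
    have hq : ∃ q, e = q + t • g (i + 1) ∧ mon 𝕜 q ∈ I ^ (r + 1 + m + D) := by
      refine C.exists_eq_add_nsmul (by omega) (by omega) ?_ (fun hk => Or.inr ?_) he
      · intro n hn hni
        obtain rfl : n = i := by omega
        rw [e2]
        omega
      · have h2 := C.snd_lt (i + 1) (i + 2) (by omega) (by omega) (by omega)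
        have := Nat.mul_le_mul_left (r + 1) h2
        have h3 := Nat.mul_le_mul_left m (h2.le.trans (C.snd_le h1 (Nat.le_succ i) (by omega)))
        rw [Nat.succ_eq_add_one, mul_add] at this
        rw [show i + 1 + 1 = i + 2 from rfl, e3]
        omega
    obtain ⟨q, rfl, hq⟩ := hq
    simp only [Prod.fst_add, Prod.snd_add, Prod.smul_fst, Prod.smul_snd, smul_eq_mul]
      at he1 he2 he3
    have hq' : ∃ f, q = f + m • g i ∧ mon 𝕜 f ∈ I ^ (r + 1 + D) := by
      refine C.exists_eq_add_nsmul h1 (by omega) ?_ (fun _ => Or.inl ?_) hq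
      · intro n hn hni
        have := Nat.mul_le_mul_left (r + 1 + 1) (C.snd_le hn (by omega : n ≤ i) (by omega))
        have := e1 (g i).2
        omega
      · rw [e1]; omega
    obtain ⟨f, rfl, hf⟩ := hq'
    exact ⟨f, rfl, hf⟩
  have hmin := mem_mingens_iff.1 S.mem_mingens
  refine mem_mingens_iff.2 ⟨?_, fun a ha h => ?_, fun b hb h => ?_⟩
  · rw [show r + 1 + m + t + D = r + 1 + D + t + m by ring]
    exact add_mem_pow (add_mem_pow (C.mem_pow_of_mem_segIdeal S S.mem_mingens.1)
      (nsmul_mem_pow (C.mem (by omega) (by omega)) t)) (nsmul_mem_pow (C.mem h1 (by omega)) m)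
  · obtain ⟨q, hq, hmem⟩ := hdown _ (by simp only at ha ⊢; omega) (by simp) (by simp) h
    obtain ⟨x, hx⟩ : ∃ x, x + 1 = p.1 := by
      have := C.u_le_fst S
      exact ⟨p.1 - 1, by omega⟩
    refine hmin.2.1 x hx (C.mon_mem_segIdeal_of_mem_pow S (hB.trans hle) hlt ?_)
    convert hmem using 2
    have h5 := congrArg Prod.fst hq
    have h6 := congrArg Prod.snd hq
    simp only [Prod.fst_add, Prod.snd_add] at ha h5 h6
    ext <;> simp only [Prod.fst_add, Prod.snd_add] <;> omega
  · obtain ⟨q, hq, hmem⟩ := hdown _ (by simp) (by simp only at hb ⊢; omega)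
      (by simp only at hb ⊢; omega) h
    have h5 := congrArg Prod.fst hq
    have h6 := congrArg Prod.snd hq
    simp only [Prod.fst_add, Prod.snd_add] at hb h5 h6
    -- If `p.2 = B`, lowering y by one leaves the generic range; the second alternative of
    -- `inBand_of_mem` covers this, with its x-bound from `fst_le_mul`.
    have hband : InBand I g D (r + 1) i q :=
      C.inBand_of_mem (by omega) h1 hi (by omega) (Or.inr ⟨by omega, by omega⟩) hmem
    have hqy := C.mul_snd_le h1 (Nat.lt_succ_self i) (by omega) hband
    rw [Nat.succ_eq_add_one] at hqy
    refine hmin.2.2 (q.2 - (corner g r i).2) (by omega)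
      ((C.mon_mem_segIdeal_iff_inBand h1 hi).2 ?_)
    convert hband using 1
    ext <;> simp only [Prod.fst_add, Prod.snd_add] <;> omega

end

end BandDecomposition

end Segments

/-! ### Stable components as colon ideals of powers of I. -/

section Components

variable {𝕜 : Type*} [Field 𝕜]

namespace IsSegmentPoint

/-- Between the bounds of `M`, the ideal of the `i`-th band is generated by `M` and the cut
point. -/
lemma exists_setM_le {I : Ideal (Poly 𝕜)} {k : ℕ} {g : ℕ → ℕ × ℕ} {D B r i u v : ℕ} {p : ℕ × ℕ}
    (S : IsSegmentPoint I k g D B r i u v p) {f : ℕ × ℕ} (hf : mon 𝕜 f ∈ segIdeal (g i) (g (i + 1)) (I ^ D) r)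
    (hy : f.2 < (r + 1) * v) :
    (∃ m ∈ setM (g i) (g (i + 1)) (I ^ D) r, m ≤ f) ∨ p.1 ≤ f.1 := by
  obtain ⟨m, hm, hle⟩ := exists_mingens_le hf
  rcases lt_or_ge m.2 (r * v) with h | h
  · exact Or.inr ((S.fst_lt_of_mingens hm h).le.trans hle.1)
  · refine Or.inl ⟨m, ⟨hm, ?_, ?_⟩, hle⟩ <;> rw [S.pairY_eq]
    · exact h
    · exact hle.2.trans_lt hy

end IsSegmentPoint

namespace BandDecomposition

variable {I : Ideal (Poly 𝕜)} {k : ℕ} {g : ℕ → ℕ × ℕ} {D B : ℕ}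
  (C : BandDecomposition I k g D B)
include C

lemma inBand_iff_exists {r i : ℕ} (h1 : 1 ≤ i) (hi : i ≤ k) {e : ℕ × ℕ} :
    InBand I g D (r + 1) i e ↔ ∃ f, e = f + corner g r i ∧
      mon 𝕜 f ∈ segIdeal (g i) (g (i + 1)) (I ^ D) r := by
  constructor
  · intro h
    obtain ⟨f, rfl⟩ := exists_add_of_le (show corner g r i ≤ e from
      ⟨C.mul_fst_le h1 le_rfl hi h, C.mul_snd_le h1 (Nat.lt_succ_self i) (by omega) h⟩)
    rw [add_comm (corner g r i)] at h
    exact ⟨f, add_comm _ _, (C.mon_mem_segIdeal_iff_inBand h1 hi).2 h⟩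
  · rintro ⟨f, rfl, hf⟩
    exact (C.mon_mem_segIdeal_iff_inBand h1 hi).1 hf

section

variable {r i u v : ℕ} {p : ℕ × ℕ} (S : IsSegmentPoint I k g D B r i u v p)
include S

/-- A lower generator of the power satisfying the bound would lie where the power is band i, hence
come from a generator of the band that contradicts the choice of `p`. -/
lemma linkPoint_eq : linkPoint I k g D (r + 1 + D) i = p + corner g r i := by
  have h1 := S.one_le
  have hi := S.le
  rw [linkPoint, if_neg (by omega), if_neg (by omega), S.pairY_eq,
    show r + 1 + D - D - 1 = r by omega]
  refine lowestGen_eq (by simpa using C.add_nsmul_mem_mingens S 0 0) ?_ fun f hf hfy => ?_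
  · have := S.le_snd
    rw [Prod.snd_add, corner_snd]; omega
  · by_contra! hlt
    have hc := S.corner_add_mul
    have hcs := corner_snd g r i
    have hB := S.bound_le
    have hp := S.snd_lt
    rw [Prod.snd_add] at hlt
    obtain ⟨q, rfl, hq⟩ := (C.inBand_iff_exists h1 hi).1
      (C.inBand_of_mem (by omega) h1 hi (by omega) (Or.inl (by omega)) hf.1)
    obtain ⟨m, hm, hle⟩ := exists_mingens_le hq
    have heq : m = q := add_right_cancel (eq_of_le_mingens hf (C.mem_pow_of_mem_segIdeal S hm.1)
      (add_le_add_left hle _))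
    subst heq
    rw [Prod.snd_add] at hlt hfy
    have := S.snd_le m hm (by omega)
    omega

/-- Stability of H_i: the left-hand side involves neither `m` nor `t`. -/
lemma mon_mem_segH (m t : ℕ) {e : ℕ × ℕ} : mon 𝕜 e ∈ segH (g i) (g (i + 1)) (I ^ D) r ↔
    mon 𝕜 (e + (p.1 - u, p.2) + corner g r i + t • g (i + 1) + m • g i) ∈
      I ^ (r + 1 + m + t + D) := by
  have h1 := S.one_le
  have hi := S.le
  have hc := S.corner_add_mul
  have hcs := corner_snd g r i
  have hB := S.bound_le
  have hle := S.le_snd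
  have hlt := S.snd_lt
  have hse := S.snd_eq
  have hup := C.swap_up_segIdeal S S.mem_mingens.1 S.snd_lt
  rw [segH, mon_mem_colonMon, S.segPoint_eq, mon_mem_monIdeal, S.pairX_eq, S.pairY_eq]
  generalize hfe : e + (p.1 - u, p.2) = f
  have hf1 : p.1 - u ≤ f.1 := by simp [← hfe]
  have hf2 : p.2 ≤ f.2 := by simp [← hfe]
  clear hfe
  constructor
  · rintro ⟨q, hq, hqf⟩
    have hqK : mon 𝕜 q ∈ segIdeal (g i) (g (i + 1)) (I ^ D) r := by
      rcases hq with hq | rfl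
      · exact hq.1.1
      · exact hup.2
    rw [show r + 1 + m + t + D = r + 1 + D + t + m by ring]
    exact add_mem_pow (add_mem_pow (C.mem_pow_of_mem_segIdeal S (mon_mem_of_le hqK hqf))
      (nsmul_mem_pow (C.mem (by omega) (by omega)) t)) (nsmul_mem_pow (C.mem h1 (by omega)) m)
  · intro hmem
    have e1 : ∀ a, (r + 1 + 1) * a = (r + 1) * a + a := fun a => by ring
    have e2 : ∀ a, (r + 1 + m + 1) * a = (r + 1) * a + m * a + a := fun a => by ring
    have e3 : ∀ a, (r + 1 + m) * a = (r + 1) * a + m * a := fun a => by ring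
    rcases le_or_gt (p.2 + v) f.2 with h | hfv
    · exact ⟨_, Or.inr rfl, hf1, h⟩
    have hcut : (∃ q ∈ setM (g i) (g (i + 1)) (I ^ D) r, q ≤ f) ∨ p.1 ≤ f.1 →
        ∃ q ∈ setM (g i) (g (i + 1)) (I ^ D) r ∪ {(p.1 - u, p.2 + v)}, q ≤ f := by
      rintro (⟨q, hq, hqf⟩ | h)
      · exact ⟨q, Or.inl hq, hqf⟩
      · refine ⟨p, Or.inl ⟨S.mem_mingens, ?_, ?_⟩, h, hf2⟩ <;> rw [S.pairY_eq] <;> assumption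
    have hmem1 : mon 𝕜 (f + corner g r i + m • g i) ∈ I ^ (r + 1 + m + D) := by
      rw [add_right_comm (f + corner g r i)] at hmem
      refine C.mem_of_add_nsmul_mem (j := i + 1) (by omega) (by omega) ?_ (fun hk => ?_) hmem
      · intro n hn hni
        obtain rfl : n = i := by omega
        simp only [Prod.snd_add, Prod.smul_snd, smul_eq_mul, e2]
        omega
      · have h2 := C.snd_lt (i + 1) (i + 2) (by omega) (by omega) (by omega)
        have := Nat.mul_le_mul_left (r + 1) h2.le
        have h3 := Nat.mul_le_mul_left m (h2.le.trans (C.snd_le h1 (Nat.le_succ i) (by omega)))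
        rw [show i + 1 + 1 = i + 2 from rfl, e3]
        simp only [Prod.snd_add, Prod.smul_snd, smul_eq_mul]
        omega
    have hrem : ∀ q : ℕ × ℕ, B ≤ q.2 → q.2 < (r + 1) * v →
        mon 𝕜 (q + corner g r i + m • g i) ∈ I ^ (r + 1 + m + D) →
        mon 𝕜 q ∈ segIdeal (g i) (g (i + 1)) (I ^ D) r := by
      intro q hq1 hq2 hq
      refine C.mon_mem_segIdeal_of_mem_pow S hq1 hq2
        (C.mem_of_add_nsmul_mem h1 (by omega) ?_ (fun _ => ?_) hq)
      · intro n hn hni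
        have := Nat.mul_le_mul_left (r + 1 + 1) (C.snd_le hn (by omega : n ≤ i) (by omega))
        have := e1 (g i).2
        rw [Prod.snd_add]
        omega
      · rw [Prod.snd_add]; omega
    rcases lt_or_ge f.2 ((r + 1) * v) with hfN | hfN
    · exact hcut (S.exists_setM_le (hrem f (by omega) hfN hmem1) hfN)
    -- The heights from (r + 1)v to below β + v remain. Trading g_i for g_(i+1) leads to an element
    -- lower than `p`, whose generator is lower than r v by the choice of `p`. So the element may be
    -- lowered to height r v - 1, and trading x^u back for y^v gives x-degree `f.1` at height (r +
    -- 1)v - 1, within reach of M.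
    have hrv : (r + 1) * v = r * v + v := by ring
    obtain ⟨q, hq, hqmem⟩ := C.exists_swap_down (N := r + 1 + m) h1 hi
      (by simp only [Prod.snd_add, Prod.smul_snd, smul_eq_mul, e2]; omega)
      (by
        have := Nat.mul_le_mul_left m (C.snd_le h1 (Nat.le_succ i) (by omega))
        simp only [Prod.snd_add, Prod.smul_snd, smul_eq_mul, e3]
        simp only [Nat.succ_eq_add_one] at this
        omega) hmem1
    have hqe : q = (f.1 + u, f.2 - v) + corner g r i + m • g i := by
      have h5 := congrArg Prod.fst hq
      have h6 := congrArg Prod.snd hq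
      have := S.fst_eq
      simp only [Prod.fst_add, Prod.snd_add] at h5 h6
      ext <;> simp only [Prod.fst_add, Prod.snd_add] <;> omega
    rw [hqe] at hqmem
    have hK := hrem _ (by simp only; omega) (by simp only; omega) hqmem
    obtain ⟨n, hn, hnle⟩ := exists_mingens_le hK
    have hn2 := hnle.2
    simp only at hn2
    have hnr : n.2 < r * v := by
      by_contra! h
      have := S.snd_le n hn h
      omega
    have hK' : mon 𝕜 (f.1 + u, r * v - 1) ∈ segIdeal (g i) (g (i + 1)) (I ^ D) r :=
      mon_mem_of_le hn.1 ⟨hnle.1, by simp only; omega⟩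
    have hK2 := (C.swap_up_segIdeal S hK' (by simp only; omega)).2
    simp only [Nat.add_sub_cancel] at hK2
    refine hcut ((S.exists_setM_le hK2 (by simp only; omega)).imp_left ?_)
    rintro ⟨q, hq, hqf⟩
    exact ⟨q, hq, hqf.trans ⟨le_rfl, by simp only; omega⟩⟩

/-- Removing a power of `g (i + 1)` above the next cut point. -/
lemma mem_of_add_nsmul_succ_mem {f : ℕ × ℕ} {l : ℕ} (hx : (p + corner g r i).1 ≤ f.1)
    (hlow : i + 1 ≤ k → (r + 1) * (g (i + 2)).2 + B ≤ f.2)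
    (hf : mon 𝕜 (f + l • g (i + 1)) ∈ I ^ (r + 1 + l + D)) : mon 𝕜 f ∈ I ^ (r + 1 + D) := by
  have h1 := S.one_le
  have hi := S.le
  have hc := S.corner_add_mul
  have hlt := S.snd_lt
  have hse := S.snd_eq
  rcases le_or_gt (p + corner g r i).2 f.2 with h | h
  · exact mon_mem_of_le (C.mem_pow_of_mem_segIdeal S S.mem_mingens.1) ⟨hx, h⟩
  · rw [Prod.snd_add] at h
    refine C.mem_of_add_nsmul_mem (j := i + 1) (by omega) (by omega) ?_ hlow hf
    intro n hn hni
    obtain rfl : n = i := by omega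
    rw [add_mul _ 1, one_mul]
    omega

/-- Earlier bands lie higher than h_i, so to the right of h_i their monomials are multiples of h_i,
which belongs to band i. -/
lemma inBand_of_mem_of_lt {f : ℕ × ℕ} {j : ℕ} (hx : (p + corner g r i).1 ≤ f.1) (hj : 1 ≤ j)
    (hji : j < i) (h : InBand I g D (r + 1) j f) : InBand I g D (r + 1) i f := by
  have hc := S.corner_add_mul
  have hlt := S.snd_lt
  have h2 := C.mul_snd_le hj hji (by have := S.le; omega) h
  obtain ⟨s, t, hst, w, hw, hle⟩ :=
    (C.mon_mem_segIdeal_iff_inBand S.one_le S.le).1 S.mem_mingens.1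
  exact ⟨s, t, hst, w, hw, hle.trans ⟨hx, by rw [Prod.snd_add]; omega⟩⟩

lemma inBand_of_mem_of_gt {f : ℕ × ℕ} {j : ℕ} (hy : (p + corner g r i).2 ≤ f.2) (hij : i < j)
    (hj : j ≤ k) (h : InBand I g D (r + 1) j f) : InBand I g D (r + 1) i f := by
  have h1 := S.le_snd
  have h2 := S.bound_le
  rw [Prod.snd_add, corner_snd] at hy
  exact C.inBand_of_lt S.one_le hij hj h (by omega)

lemma mon_mem_segA_iff {a : ℕ × ℕ} : mon 𝕜 a ∈ segA (g i) (g (i + 1)) (I ^ D) r ↔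
    InBand I g D (r + 1) i (a + (0, p.2) + corner g r i) := by
  rw [S.mon_mem_segA, C.mon_mem_segIdeal_iff_inBand S.one_le S.le]

lemma mon_mem_segB_iff {a : ℕ × ℕ} : mon 𝕜 a ∈ segB (g i) (g (i + 1)) (I ^ D) r ↔
    InBand I g D (r + 1) i (a + (p.1, 0) + corner g r i) := by
  rw [S.mon_mem_segB, C.mon_mem_segIdeal_iff_inBand S.one_le S.le]

lemma add_nsmul_mem_pow {j l : ℕ} {f : ℕ × ℕ} (h1 : 1 ≤ j) (hj : j ≤ k + 1)
    (hb : InBand I g D (r + 1) i f) : mon 𝕜 (f + l • g j) ∈ I ^ (r + 1 + l + D) := by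
  rw [show r + 1 + l + D = r + 1 + D + l by ring]
  exact add_mem_pow (C.mem_of_inBand S.one_le S.le hb) (nsmul_mem_pow (C.mem h1 hj) l)

end

lemma mon_mem_segA_first {r u v : ℕ} {p : ℕ × ℕ} (S : IsSegmentPoint I k g D B r 1 u v p) (l : ℕ)
    {e : ℕ × ℕ} : mon 𝕜 e ∈ segA (g 1) (g (1 + 1)) (I ^ D) r ↔
      mon 𝕜 (e + (0, (p + corner g r 1).2) + l • g 1) ∈ I ^ (r + 1 + l + D) := by
  have h0 : e + (0, (p + corner g r 1).2) = e + (0, p.2) + corner g r 1 := by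
    have := corner_fst g r 1
    rw [C.fst_first, mul_zero] at this
    ext <;> simp only [Prod.fst_add, Prod.snd_add] <;> omega
  have hy : (p + corner g r 1).2 ≤ (e + (0, p.2) + corner g r 1).2 := by
    simp only [Prod.snd_add]; omega
  rw [C.mon_mem_segA_iff S, h0]
  refine ⟨fun h => C.add_nsmul_mem_pow S le_rfl (by omega) h, fun h => ?_⟩
  have hb := S.bound_le
  have hle := S.le_snd
  obtain ⟨j, hj1, hj, hband⟩ := C.exists_inBand _ _ (C.mem_of_add_nsmul_mem le_rfl (by omega)
    (fun m hm hm1 => by omega)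
    (fun _ => by rw [Prod.snd_add, Prod.snd_add, corner_snd]; simp only; omega) h)
  rcases hj1.eq_or_lt with rfl | hlt
  · exact hband
  · exact C.inBand_of_mem_of_gt S hy hlt hj hband

lemma mon_mem_segB_last {r u v : ℕ} {p : ℕ × ℕ} (S : IsSegmentPoint I k g D B r k u v p) (l : ℕ)
    {e : ℕ × ℕ} : mon 𝕜 e ∈ segB (g k) (g (k + 1)) (I ^ D) r ↔
      mon 𝕜 (e + ((p + corner g r k).1, 0) + l • g (k + 1)) ∈ I ^ (r + 1 + l + D) := by
  have h0 : e + ((p + corner g r k).1, 0) = e + (p.1, 0) + corner g r k := by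
    have := corner_snd g r k
    rw [C.snd_last, mul_zero] at this
    ext <;> simp only [Prod.fst_add, Prod.snd_add] <;> omega
  have hx : (p + corner g r k).1 ≤ (e + (p.1, 0) + corner g r k).1 := by
    simp only [Prod.fst_add]; omega
  rw [C.mon_mem_segB_iff S, h0]
  refine ⟨fun h => C.add_nsmul_mem_pow S (by omega) (by omega) h, fun h => ?_⟩
  obtain ⟨j, hj1, hj, hband⟩ := C.exists_inBand _ _
    (C.mem_of_add_nsmul_succ_mem S hx (fun h => by omega) h)
  rcases hj.eq_or_lt with rfl | hlt
  · exact hband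
  · exact C.inBand_of_mem_of_lt S hx hj1 hlt hband

/-- Between h_i and h_(i+1), band i absorbs all earlier bands and band i + 1 all later ones. The
summands are the traces of these two bands; the monomial factors account for their different
corners. -/
lemma mon_mem_segments_middle {r i u v u' v' : ℕ} {p p' : ℕ × ℕ}
    (S : IsSegmentPoint I k g D B r i u v p) (S' : IsSegmentPoint I k g D B r (i + 1) u' v' p')
    (l : ℕ) {e : ℕ × ℕ} :
    mon 𝕜 e ∈ segB (g i) (g (i + 1)) (I ^ D) r * monIdeal 𝕜 {(0, (r + 1) * v' - p'.2)} +
        segA (g (i + 1)) (g (i + 2)) (I ^ D) r * monIdeal 𝕜 {((r + 1) * u - p.1, 0)} ↔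
      mon 𝕜 (e + ((p + corner g r i).1, (p' + corner g r (i + 1)).2) + l • g (i + 1)) ∈
        I ^ (r + 1 + l + D) := by
  have hi := S.le
  have hi' := S'.le
  have mB : IsMonomialIdeal (segB (g i) (g (i + 1)) (I ^ D) r) :=
    (isMonomialIdeal_monIdeal _).colonMon _
  have mA : IsMonomialIdeal (segA (g (i + 1)) (g (i + 2)) (I ^ D) r) :=
    (isMonomialIdeal_monIdeal _).colonMon _
  rw [(mB.mul (isMonomialIdeal_monIdeal _)).mon_mem_add (mA.mul (isMonomialIdeal_monIdeal _)),
    mon_mem_mul_monIdeal_singleton mB, mon_mem_mul_monIdeal_singleton mA]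
  set f := e + ((p + corner g r i).1, (p' + corner g r (i + 1)).2) with hf
  have hc := S.corner_add_mul
  have hc' := S'.corner_add_mul
  have hx := C.fst_le_mul S
  have hy := S'.snd_lt
  have hci := corner_snd g r i
  have hci' := corner_fst g r (i + 1)
  have hci2 := corner_snd g r (i + 1)
  have hfx : (p + corner g r i).1 ≤ f.1 := Nat.le_add_left _ _
  have hfy : (p' + corner g r (i + 1)).2 ≤ f.2 := Nat.le_add_left _ _
  have hB : (∃ a, mon 𝕜 a ∈ segB (g i) (g (i + 1)) (I ^ D) r ∧ e = a + (0, (r + 1) * v' - p'.2)) ↔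
      InBand I g D (r + 1) i f := by
    constructor
    · rintro ⟨a, ha, he⟩
      rw [C.mon_mem_segB_iff S] at ha
      convert ha using 1
      rw [hf, he]
      ext <;> simp only [Prod.fst_add, Prod.snd_add] <;> omega
    · intro h
      have h2 := C.mul_snd_le S.one_le (Nat.lt_succ_self i) (by omega) h
      rw [Nat.succ_eq_add_one, hf, Prod.snd_add, Prod.snd_add] at h2
      refine ⟨(e.1, e.2 - ((r + 1) * v' - p'.2)), (C.mon_mem_segB_iff S).2 ?_, ?_⟩
      · convert h using 1
        rw [hf]
        ext <;> simp only [Prod.fst_add, Prod.snd_add] <;> omega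
      · ext <;> simp only [Prod.fst_add, Prod.snd_add] <;> omega
  have hA : (∃ a, mon 𝕜 a ∈ segA (g (i + 1)) (g (i + 2)) (I ^ D) r ∧
      e = a + ((r + 1) * u - p.1, 0)) ↔ InBand I g D (r + 1) (i + 1) f := by
    constructor
    · rintro ⟨a, ha, he⟩
      have ha' := (C.mon_mem_segA_iff S').1 ha
      convert ha' using 1
      rw [hf, he]
      ext <;> simp only [Prod.fst_add, Prod.snd_add] <;> omega
    · intro h
      have h2 := C.mul_fst_le (m := i + 1) (by omega) le_rfl hi' h
      rw [hf, Prod.fst_add, Prod.fst_add] at h2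
      refine ⟨(e.1 - ((r + 1) * u - p.1), e.2), (C.mon_mem_segA_iff S').2 ?_, ?_⟩
      · convert h using 1
        rw [hf]
        ext <;> simp only [Prod.fst_add, Prod.snd_add] <;> omega
      · ext <;> simp only [Prod.fst_add, Prod.snd_add] <;> omega
  rw [hA, hB]
  constructor
  · rintro (h | h)
    · exact C.add_nsmul_mem_pow S (by omega) (by omega) h
    · exact C.add_nsmul_mem_pow S' (by omega) (by omega) h
  · intro h
    obtain ⟨j, hj1, hj, hband⟩ := C.exists_inBand _ _
      (C.mem_of_add_nsmul_succ_mem S hfx (fun _ => by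
        have h1 := S'.bound_le
        have h2 := S'.le_snd
        rw [Prod.snd_add] at hfy
        rw [show i + 2 = i + 1 + 1 from rfl]
        omega) h)
    rcases lt_trichotomy j i with hlt | rfl | hlt
    · exact Or.inl (C.inBand_of_mem_of_lt S hfx hj1 hlt hband)
    · exact Or.inl hband
    · rcases (show i + 1 ≤ j from hlt).eq_or_lt with rfl | hlt
      · exact Or.inr hband
      · exact Or.inr (C.inBand_of_mem_of_gt S' hfy hlt hj hband)

end BandDecomposition

end Components

/-! ### Assembling the link decomposition. -/

section Assembly

variable {𝕜 : Type*} [Field 𝕜]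

lemma linkPoint_zero (I : Ideal (Poly 𝕜)) (k : ℕ) (g : ℕ → ℕ × ℕ) (D s : ℕ) :
    linkPoint I k g D s 0 = s • g 1 := by
  simp [linkPoint]

lemma linkPoint_last (I : Ideal (Poly 𝕜)) (k : ℕ) (g : ℕ → ℕ × ℕ) (D s : ℕ) :
    linkPoint I k g D s (k + 1) = s • g (k + 1) := by
  simp [linkPoint]

namespace BandDecomposition

variable {I : Ideal (Poly 𝕜)} {k : ℕ} {g : ℕ → ℕ × ℕ} {D B : ℕ}
  (C : BandDecomposition I k g D B)
include C

section

variable {r i u v : ℕ} {p : ℕ × ℕ} (S : IsSegmentPoint I k g D B r i u v p)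
include S

lemma linkPoint_add_mem_mingens (t m : ℕ) :
    linkPoint I k g D (r + 1 + D) i + t • g (i + 1) + m • g i ∈
      mingens (I ^ (r + 1 + D + (t + m))) := by
  rw [C.linkPoint_eq S, show r + 1 + D + (t + m) = r + 1 + m + t + D by ring]
  exact C.add_nsmul_mem_mingens S t m

/-- As g_i and g_(i+1) differ by u in x-degree, the gcd of these two points is (h_i / x^u)
g_(i+1)^(t+1) g_i^m, the monomial of `mon_mem_segH`. -/
lemma stableH_eq (t m : ℕ) : stableH I g D (r + 1 + D) i =
    between (I ^ (r + 1 + D + (t + (m + 1))))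
      (linkPoint I k g D (r + 1 + D) i + t • g (i + 1) + (m + 1) • g i)
      (linkPoint I k g D (r + 1 + D) i + (t + 1) • g (i + 1) + m • g i) := by
  refine ((isMonomialIdeal_monIdeal _).colonMon _).ext ((C.isMonomial.pow _).colonMon _)
    fun e => ?_
  change mon 𝕜 e ∈ segH (g i) (g (i + 1)) (I ^ D) (r + 1 + D - D - 1) ↔
    mon 𝕜 e ∈ between _ _ _
  rw [show r + 1 + D - D - 1 = r by omega, C.mon_mem_segH S m (t + 1), mon_mem_between,
    C.linkPoint_eq S, show r + 1 + D + (t + (m + 1)) = r + 1 + m + (t + 1) + D by ring]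
  have hu := C.u_le_fst S
  have hfe := S.fst_eq
  refine iff_of_eq ?_
  congr 2
  ext
  · simp only [Prod.fst_add, Prod.smul_fst, smul_eq_mul, add_mul, one_mul]; omega
  · simp only [Prod.snd_add, Prod.smul_snd, smul_eq_mul, add_mul, one_mul]; omega

lemma stableH_eq_colonMon : stableH I g D (r + 1 + D) i = colonMon (I ^ (r + 1 + D))
    (linkPoint I k g D (r + 1 + D) i - (pairX 𝕜 (g i) (g (i + 1)), 0)) := by
  refine ((isMonomialIdeal_monIdeal _).colonMon _).ext ((C.isMonomial.pow _).colonMon _)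
    fun e => ?_
  change mon 𝕜 e ∈ segH (g i) (g (i + 1)) (I ^ D) (r + 1 + D - D - 1) ↔ _
  rw [show r + 1 + D - D - 1 = r by omega, C.mon_mem_segH S 0 0, mon_mem_colonMon,
    C.linkPoint_eq S, S.pairX_eq]
  have hu := C.u_le_fst S
  refine iff_of_eq ?_
  congr 2
  ext
  · simp only [Prod.fst_add, Prod.fst_sub, zero_nsmul, Prod.fst_zero]; omega
  · simp only [Prod.snd_add, Prod.snd_sub, zero_nsmul, Prod.snd_zero]; omega

end

variable {r : ℕ} (hr : ∀ i, 1 ≤ i → i ≤ k → B ≤ r * pairY 𝕜 (g i) (g (i + 1)))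
include hr

lemma stableC_eq {i : ℕ} (hi : i ≤ k) (l : ℕ) : stableC I k g D (r + 1 + D) i =
    between (I ^ (r + 1 + D + l)) (linkPoint I k g D (r + 1 + D) i + l • g (i + 1))
      (linkPoint I k g D (r + 1 + D) (i + 1) + l • g (i + 1)) := by
  have hk := C.one_le
  have hpow : r + 1 + D + l = r + 1 + l + D := by ring
  have hseg : ∀ (G : Set (ℕ × ℕ)) (m : ℕ × ℕ), IsMonomialIdeal (colonMon (monIdeal 𝕜 G) m) :=
    fun G m => (isMonomialIdeal_monIdeal G).colonMon m
  have hm : IsMonomialIdeal (between (I ^ (r + 1 + D + l))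
      (linkPoint I k g D (r + 1 + D) i + l • g (i + 1))
      (linkPoint I k g D (r + 1 + D) (i + 1) + l • g (i + 1))) := (C.isMonomial.pow _).colonMon _
  unfold stableC
  simp only [show r + 1 + D - D - 1 = r by omega]
  rcases Nat.eq_zero_or_pos i with rfl | hi0
  · rw [if_pos rfl]
    obtain ⟨u, v, p, S⟩ := C.exists_isSegmentPoint le_rfl hk (hr 1 le_rfl hk)
    refine (hseg _ _).ext hm fun e => (C.mon_mem_segA_first S l).trans ?_
    rw [mon_mem_between, linkPoint_zero, C.linkPoint_eq S, hpow]
    have := C.fst_first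
    refine iff_of_eq ?_
    congr 2
    ext
    · simp only [Prod.fst_add, Prod.smul_fst, smul_eq_mul, zero_add, this]; omega
    · simp only [Prod.snd_add, Prod.smul_snd, smul_eq_mul, zero_add]; omega
  · rw [if_neg hi0.ne']
    obtain ⟨u, v, p, S⟩ := C.exists_isSegmentPoint hi0 hi (hr i hi0 hi)
    rcases hi.eq_or_lt with rfl | hlt
    · rw [if_pos rfl]
      refine (hseg _ _).ext hm fun e => (C.mon_mem_segB_last S l).trans ?_
      rw [mon_mem_between, linkPoint_last, C.linkPoint_eq S, hpow]
      have := C.snd_last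
      refine iff_of_eq ?_
      congr 2
      ext
      · simp only [Prod.fst_add, Prod.smul_fst, smul_eq_mul]; omega
      · simp only [Prod.snd_add, Prod.smul_snd, smul_eq_mul, this]; omega
    · rw [if_neg hlt.ne]
      obtain ⟨u', v', p', S'⟩ :=
        C.exists_isSegmentPoint (i := i + 1) (by omega) hlt (hr (i + 1) (by omega) hlt)
      rw [C.distX_segA S, show i + 2 = i + 1 + 1 from rfl, C.distY_segB S', S'.pairY_eq,
        S.pairX_eq]
      refine (((hseg _ _).mul (isMonomialIdeal_monIdeal _)).add
        ((hseg _ _).mul (isMonomialIdeal_monIdeal _))).ext hm fun e =>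
        (C.mon_mem_segments_middle S S' l).trans ?_
      rw [mon_mem_between, C.linkPoint_eq S, C.linkPoint_eq S', hpow]
      refine iff_of_eq ?_
      congr 2
      ext <;> simp only [Prod.fst_add, Prod.snd_add] <;> omega

/-- For i < k the height (r + 1) deg_y g_(i+1) separates the two points. -/
lemma linkPoint_succ_snd_le {i : ℕ} (hi : i ≤ k) :
    (linkPoint I k g D (r + 1 + D) (i + 1)).2 ≤ (linkPoint I k g D (r + 1 + D) i).2 := by
  have hk := C.one_le
  rcases hi.eq_or_lt with rfl | hlt
  · rw [linkPoint_last, Prod.smul_snd, C.snd_last]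
    simp
  · obtain ⟨u', v', p', S'⟩ :=
      C.exists_isSegmentPoint (i := i + 1) (by omega) hlt (hr (i + 1) (by omega) hlt)
    have hc' := S'.corner_add_mul
    have hy := S'.snd_lt
    rw [C.linkPoint_eq S', Prod.snd_add]
    rcases Nat.eq_zero_or_pos i with rfl | hi0
    · rw [linkPoint_zero, Prod.smul_snd, smul_eq_mul, add_mul]
      simp only [zero_add] at *
      omega
    · obtain ⟨u, v, p, S⟩ := C.exists_isSegmentPoint hi0 hi (hr i hi0 hi)
      have hc := corner_snd g r i
      rw [C.linkPoint_eq S, Prod.snd_add]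
      omega

lemma linkPoint_add_nsmul_mem_mingens {i j : ℕ} (l : ℕ) (hi : i ≤ k + 1) (hj1 : 1 ≤ j)
    (hj : j ≤ k + 1) (hij : j = i ∨ j = i + 1) :
    linkPoint I k g D (r + 1 + D) i + l • g j ∈ mingens (I ^ (r + 1 + D + l)) := by
  rcases Nat.eq_zero_or_pos i with rfl | hi0
  · obtain rfl : j = 1 := by omega
    rw [linkPoint_zero, ← add_nsmul]
    exact C.nsmul_mem_mingens hj1 hj
  rcases hi.eq_or_lt with rfl | hlt
  · obtain rfl : j = k + 1 := by omega
    rw [linkPoint_last, ← add_nsmul]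
    exact C.nsmul_mem_mingens hj1 hj
  obtain ⟨u, v, p, S⟩ := C.exists_isSegmentPoint hi0 (by omega) (hr i hi0 (by omega))
  rcases hij with rfl | rfl
  · simpa using C.linkPoint_add_mem_mingens S 0 l
  · simpa using C.linkPoint_add_mem_mingens S l 0

lemma linkPow_stableH {i : ℕ} (h1 : 1 ≤ i) (hi : i ≤ k) (l : ℕ) :
    linkPow (stableH I g D (r + 1 + D) i) l = between (I ^ (r + 1 + D + l))
      (linkPoint I k g D (r + 1 + D) i + l • g i)
      (linkPoint I k g D (r + 1 + D) i + l • g (i + 1)) := by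
  obtain ⟨u, v, p, S⟩ := C.exists_isSegmentPoint h1 hi (hr i h1 hi)
  -- Trading one `g i` for `g (i + 1)` at a time cuts the portion into `l` consecutive copies of
  -- H_i.
  have hlist : List.replicate l (stableH I g D (r + 1 + D) i) =
      (List.range' 0 l).map fun t => between (I ^ (r + 1 + D + l))
        (linkPoint I k g D (r + 1 + D) i + t • g (i + 1) + (l - t) • g i)
        (linkPoint I k g D (r + 1 + D) i + (t + 1) • g (i + 1) + (l - (t + 1)) • g i) := by
    rw [eq_comm, List.eq_replicate_iff]
    refine ⟨by simp, fun J hJ => ?_⟩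
    obtain ⟨t, ht, rfl⟩ := List.mem_map.1 hJ
    have ht : t < l := by simpa using ht
    obtain ⟨m, rfl⟩ : ∃ m, l = t + (m + 1) := ⟨l - t - 1, by omega⟩
    rw [C.stableH_eq S t m, show t + (m + 1) - t = m + 1 by omega,
      show t + (m + 1) - (t + 1) = m by omega]
  rw [linkPow, hlist, linkList_between (C.isMonomial.pow _)
    (fun t => linkPoint I k g D (r + 1 + D) i + t • g (i + 1) + (l - t) • g i) 0 l]
  · simp
  · intro t _ ht
    have := C.linkPoint_add_mem_mingens S t (l - t)
    rwa [show t + (l - t) = l by omega] at this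
  · intro t _ ht
    obtain ⟨m, rfl⟩ : ∃ m, l = t + (m + 1) := ⟨l - t - 1, by omega⟩
    have := C.snd_le h1 (Nat.le_succ i) (by omega)
    simp only [Nat.succ_eq_add_one] at this
    rw [show t + (m + 1) - t = m + 1 by omega, show t + (m + 1) - (t + 1) = m by omega]
    simp only [Prod.snd_add, Prod.smul_snd, smul_eq_mul, add_mul, one_mul]
    omega

/-- The powers of `I` are links of the stable components. -/
theorem pow_eq_link (l : ℕ) : I ^ (r + 1 + D + l) =
    link (stableC I k g D (r + 1 + D) 0) (linkList ((List.range' 1 k).map fun i =>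
      link (linkPow (stableH I g D (r + 1 + D) i) l) (stableC I k g D (r + 1 + D) i))) := by
  have hT : IsMonomialIdeal (I ^ (r + 1 + D + l)) := C.isMonomial.pow _
  have hk := C.one_le
  have hle : ∀ i, 1 ≤ i → i ≤ k → (linkPoint I k g D (r + 1 + D) i + l • g (i + 1)).2 ≤
      (linkPoint I k g D (r + 1 + D) i + l • g i).2 := fun i h1 hi => by
    have := Nat.mul_le_mul_left l (C.snd_le h1 (Nat.le_succ i) (by omega))
    simp only [Nat.succ_eq_add_one] at this
    simp only [Prod.snd_add, Prod.smul_snd, smul_eq_mul]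
    omega
  have hle' : ∀ i, i ≤ k → (linkPoint I k g D (r + 1 + D) (i + 1) + l • g (i + 1)).2 ≤
      (linkPoint I k g D (r + 1 + D) i + l • g (i + 1)).2 := fun i hi => by
    have := C.linkPoint_succ_snd_le hr hi
    simp only [Prod.snd_add]
    omega
  have hmap : ((List.range' 1 k).map fun i =>
      link (linkPow (stableH I g D (r + 1 + D) i) l) (stableC I k g D (r + 1 + D) i)) =
      (List.range' 1 k).map fun i => between (I ^ (r + 1 + D + l))
        (linkPoint I k g D (r + 1 + D) i + l • g i)
        (linkPoint I k g D (r + 1 + D) (i + 1) + l • g (i + 1)) := by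
    refine List.map_congr_left fun i hi => ?_
    rw [List.mem_range'_1] at hi
    rw [C.linkPow_stableH hr hi.1 (by omega), C.stableC_eq hr (by omega) l]
    exact link_between hT
      (C.linkPoint_add_nsmul_mem_mingens hr l (by omega) (by omega) (by omega) (Or.inl rfl))
      (C.linkPoint_add_nsmul_mem_mingens hr l (by omega) (by omega) (by omega) (Or.inr rfl))
      (C.linkPoint_add_nsmul_mem_mingens hr l (by omega) (by omega) (by omega) (Or.inl rfl))
      (hle i hi.1 (by omega)) (hle' i (by omega))
  have hmono : ∀ i, i ≤ k → (linkPoint I k g D (r + 1 + D) (i + 1) + l • g (i + 1)).2 ≤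
      (linkPoint I k g D (r + 1 + D) 1 + l • g 1).2 := by
    intro i
    induction i with
    | zero => intro _; exact le_rfl
    | succ i ih =>
      intro hi
      exact ((hle' (i + 1) hi).trans (hle (i + 1) (by omega) hi)).trans (ih (by omega))
  rw [hmap, linkList_between hT (fun i => linkPoint I k g D (r + 1 + D) i + l • g i) 1 k
    (fun i h1 hi =>
      C.linkPoint_add_nsmul_mem_mingens hr l (by omega) h1 (by omega) (Or.inl rfl))
    (fun i h1 hi => (hle' i (by omega)).trans (hle i h1 (by omega))),
    C.stableC_eq hr (Nat.zero_le k) l, link_between hT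
    (C.linkPoint_add_nsmul_mem_mingens hr l (by omega) (by omega) (by omega) (Or.inr rfl))
    (C.linkPoint_add_nsmul_mem_mingens hr l (by omega) (by omega) (by omega) (Or.inl rfl))
    (C.linkPoint_add_nsmul_mem_mingens hr l (by omega) (by omega) (by omega) (Or.inl rfl))
    (hle' 0 (by omega)) (by simpa [add_comm 1 k] using hmono k le_rfl)]
  -- The outermost cut points are pure powers, so their gcd is 1 and the portion between them is the
  -- whole power.
  have hfirst := C.fst_first
  have hlast := C.snd_last
  refine hT.ext (hT.colonMon _) fun e => ?_
  rw [mon_mem_between, add_comm 1 k, linkPoint_zero, linkPoint_last]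
  simp [hfirst, hlast]

end BandDecomposition

/-- Here B = D b because g_1 = y^b is weakly persistent. A one-element chain would be a pure power
of both variables, hence 1, which is excluded. -/
lemma PersistentChain.bandDecomposition {I : Ideal (Poly 𝕜)} {k : ℕ} {g : ℕ → ℕ × ℕ}
    (C : PersistentChain I k g) {a b D : ℕ} (ha : (a, 0) ∈ mingens I) (hb : (0, b) ∈ mingens I)
    (htop : I ≠ ⊤) (hD : boundD I k g ≤ D) : BandDecomposition I k g D (D * b) := by
  have hfirst := C.first_eq hb
  have hlast := C.last_eq ha
  have hk : 1 ≤ k := by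
    rw [Nat.one_le_iff_ne_zero]
    rintro rfl
    rw [zero_add, hfirst] at hlast
    refine htop ((Ideal.eq_top_iff_one _).2 ?_)
    have := hb.1
    rw [(Prod.mk.inj hlast).2, ← Prod.zero_eq_mk, mon_zero] at this
    exact this
  have hnsmul := C.nsmul_mem_mingens (n := D) le_rfl (by omega : 1 ≤ k + 1)
  rw [hfirst] at hnsmul
  have hpure : D • ((0 : ℕ), b) = (0, D * b) := by simp
  rw [hpure] at hnsmul
  refine ⟨C, hk, by rw [hfirst], by rw [hlast], hnsmul.1, fun y hy => ?_, ⟨D * a, ?_⟩, ?_⟩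
  · by_contra! h
    have := eq_of_le_mingens hnsmul hy ⟨le_rfl, h.le⟩
    rw [Prod.mk.injEq] at this
    omega
  · have := nsmul_mem_pow ha.1 D
    simpa using this
  · intro N e he
    refine C.exists_decomposition hb ha hk (δ := deltaP 𝕜 k g) (d := dP I k) ?_ ?_ hD he
    · intro i h1 hi
      rw [← pairX_eq (𝕜 := 𝕜) (C.fst_lt h1 (Nat.lt_succ_self i) (by omega))
        (C.snd_lt i (i + 1) h1 (Nat.lt_succ_self i) (by omega)),
        ← pairY_eq (𝕜 := 𝕜) (C.fst_lt h1 (Nat.lt_succ_self i) (by omega))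
        (C.snd_lt i (i + 1) h1 (Nat.lt_succ_self i) (by omega))]
      have := Finset.le_sup (f := fun i => min (pairX 𝕜 (g i) (g (i + 1)))
        (pairY 𝕜 (g i) (g (i + 1)))) (Finset.mem_Icc.2 ⟨h1, hi⟩)
      rw [deltaP]
      simp only [Nat.succ_eq_add_one] at this ⊢
      omega
    · intro hk'
      rw [dP, if_pos (by omega), distX_eq ha hb.1, distY_eq ha.1 hb]
      omega

/-- The purpose of r_y: it ensures B ≤ r v_i, so that the cut is made where band i is the whole
power. -/
lemma mul_le_of_rY_le {I : Ideal (Poly 𝕜)} {k : ℕ} {g : ℕ → ℕ × ℕ} {D r i : ℕ} (h1 : 1 ≤ i)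
    (hi : i ≤ k) (hv : 0 < pairY 𝕜 (g i) (g (i + 1))) (hr : rY I k g D ≤ r) :
    D * distY I ≤ r * pairY 𝕜 (g i) (g (i + 1)) := by
  rw [rY, Nat.ceil_le] at hr
  have h := (mul_le_mul_of_nonneg_left (Finset.le_sup (f := fun i =>
    (distY I : ℚ≥0) / (pairY 𝕜 (g i) (g (i + 1)) : ℚ≥0)) (Finset.mem_Icc.2 ⟨h1, hi⟩))
    zero_le).trans hr
  rw [← mul_div_assoc, div_le_iff₀ (by exact_mod_cast hv)] at h
  exact_mod_cast h

end Assembly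

end StableLink

theorem theorem5 {𝕜 : Type*} [Field 𝕜] (I : Ideal (StableLink.Poly 𝕜))
    (hmon : StableLink.IsMonomialIdeal I) (hanch : StableLink.IsAnchored I)
    (hprinc : ¬ Submodule.IsPrincipal I)
    (P : Set (ℕ × ℕ)) (k : ℕ) (g : ℕ → ℕ × ℕ)
    (hP : P = g '' Set.Icc 1 (k + 1))
    (hg : StrictAntiOn (fun i => (g i).2) (Set.Icc 1 (k + 1)))
    (hP_lower : StableLink.persistent I ⊆ P)
    (hP_upper : P ⊆ StableLink.weaklyPersistent I)
    (D : ℕ) (hD : StableLink.boundD I k g ≤ D)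
    (s : ℕ) (hs : D + StableLink.rY I k g D + 1 ≤ s) :
    (∀ l : ℕ, I ^ (s + l) =
      StableLink.link (StableLink.stableC I k g D s 0)
        (StableLink.linkList ((List.range' 1 k).map fun i =>
          StableLink.link (StableLink.linkPow (StableLink.stableH I g D s i) l)
            (StableLink.stableC I k g D s i)))) ∧
    (∀ i ≤ k, StableLink.stableC I k g D s i =
      StableLink.colonMon (I ^ s)
        (StableLink.linkPoint I k g D s i ⊓ StableLink.linkPoint I k g D s (i + 1))) ∧
    (∀ i ∈ Set.Icc 1 k, StableLink.stableH I g D s i =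
      StableLink.colonMon (I ^ s)
        (StableLink.linkPoint I k g D s i -
          (StableLink.pairX 𝕜 (g i) (g (i + 1)), 0))) := by
  subst hP
  have hbot : I ≠ ⊥ := by
    rintro rfl
    exact hprinc bot_isPrincipal
  have htop : I ≠ ⊤ := by
    rintro rfl
    exact hprinc ⟨1, by simp [Ideal.submodule_span_eq]⟩
  obtain ⟨⟨a, ha⟩, b, hb⟩ := StableLink.exists_pure_powers hmon hanch hbot
  have C₀ : StableLink.PersistentChain I k g :=
    { isMonomial := hmon
      persistent_subset := hP_lower
      weaklyPersistent := fun i h1 hi => hP_upper ⟨i, ⟨h1, hi⟩, rfl⟩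
      snd_lt := fun i j h1 hij hj => hg ⟨h1, by omega⟩ ⟨by omega, hj⟩ hij }
  have C := C₀.bandDecomposition ha hb htop hD
  obtain ⟨r, rfl⟩ : ∃ r, s = r + 1 + D := ⟨s - D - 1, by omega⟩
  have hr : ∀ i, 1 ≤ i → i ≤ k → D * b ≤ r * StableLink.pairY 𝕜 (g i) (g (i + 1)) := by
    intro i h1 hi
    rw [← StableLink.distY_eq ha.1 hb]
    refine StableLink.mul_le_of_rY_le h1 hi ?_ (by omega)
    obtain ⟨u, v, -, hv, -, -, -, hY⟩ := C.exists_steps h1 hi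
    rwa [hY]
  refine ⟨C.pow_eq_link hr, fun i hi => ?_, fun i hi => ?_⟩
  -- This is stability at ℓ = 0; the order of the link points identifies the corner of the portion
  -- with their gcd.
  · have hy := C.linkPoint_succ_snd_le hr hi
    have hp : StableLink.linkPoint I k g D (r + 1 + D) i ∈
        StableLink.mingens (I ^ (r + 1 + D)) := by
      simpa using C.linkPoint_add_nsmul_mem_mingens hr (j := i + 1) 0 (by omega) (by omega)
        (by omega) (Or.inr rfl)
    have hq : StableLink.linkPoint I k g D (r + 1 + D) (i + 1) ∈
        StableLink.mingens (I ^ (r + 1 + D)) := by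
      simpa using C.linkPoint_add_nsmul_mem_mingens hr (i := i + 1) (j := i + 1) 0 (by omega)
        (by omega) (by omega) (Or.inl rfl)
    have hx := StableLink.fst_le_fst_of_snd_le_snd hp hq hy
    have hC := C.stableC_eq hr hi 0
    simp only [add_zero, zero_nsmul] at hC
    rw [hC, StableLink.between]
    congr 1
    ext
    · exact (inf_eq_left.2 hx).symm
    · exact (inf_eq_right.2 hy).symm
  · obtain ⟨u, v, p, S⟩ := C.exists_isSegmentPoint hi.1 hi.2 (hr i hi.1 hi.2)
    exact C.stableH_eq_colonMon S
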